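/- Let $\mathfrak g$ be a finite-dimensional complex simple Lie algebra with Cartan subalgebra $\mathfrak h$ and simple roots $\alpha_1,\dots,\alpha_r$. Let $(\cdot,\cdot)$ be the form on $\mathfrak h^*$ induced by the Killing form, normalized so that short roots satisfy $(\alpha,\alpha)=2$, and put $d_i=(\alpha_i,\alpha_i)/2$ and $(\alpha_i,\alpha_j)=d_ia_{ij}$. Let $q>0$, $q\neq 1$, be real and $q_i=q^{d_i}$. Let $U_q(\mathfrak g)$ be the quantized enveloping algebra with generators $E_i,F_i,K_i^{\pm1}$, with relations $K_iE_jK_i^{-1}=q_i^{a_{ij}}E_j$, $K_iF_jK_i^{-1}=q_i^{-a_{ij}}F_j$, $[E_i,F_j]=\delta_{ij}\frac{K_i-K_i^{-1}}{q_i-q_i^{-1}}$, commutativity of the $K_i$ and the quantum Serre relations, with coproduct $\Delta(K_i)=K_i\otimes K_i$, $\Delta(E_i)=E_i\otimes K_i+1\otimes E_i$, $\Delta(F_i)=F_i\otimes 1+K_i^{-1}\otimes F_i$, antipode $S(K_i)=K_i^{-1}$, $S(E_i)=-E_iK_i^{-1}$, $S(F_i)=-K_iF_i$, and $*$-structure $K_i^*=K_i$,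 $E_i^*=K_iF_i$, $F_i^*=E_iK_i^{-1}$. For $\lambda=\sum_i n_i\alpha_i$ in the root lattice write $K_\lambda=K_1^{n_1}\cdots K_r^{n_r}$. Let $\mathbb C_q[G]\subset U_q(\mathfrak g)^*$ be the span of the matrix coefficients of the finite-dimensional (type 1) representations of $U_q(\mathfrak g)$, with product $(\phi\psi)(X)=(\phi\otimes\psi)(\Delta(X))$, involution $\phi^*(X)=\overline{\phi(S(X)^*)}$ and actions $(X\triangleright\phi)(Y)=\phi(YX)$, $(\phi\triangleleft X)(Y)=\phi(XY)$. Set $$\mathbb C_q[G/T]=\{a\in\mathbb C_q[G]: K_\lambda\triangleright a=a\ \text{for all}\ \lambda\},\qquad \mathbb C_q[T\backslash G]=\{a\in\mathbb C_q[G]: a\triangleleft K_\lambda=a\ \text{for all}\ \lambda\},$$ where $\lambda$ runs over the root lattice. Let $V(\Lambda)$ be the finite-dimensional irreducible representation with dominant integral highest weight $\Lambda$, with an inner product for which $X^*$ acts as the adjoint of $X$ for all $X \in U_q(\mathfrak g)$. Let $\{v_i\}$ be an orthonormal basis of weight vectors, $v_i$ of weight $\lambda_i$, with dual basis $\{f^i\}$,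 and let $u^i_j(X)=f^i(X\triangleright v_j)$. Define matrices $\mathsf M^n_m,\mathsf N^n_m$ with entries $(\mathsf M^n_m)^i_j=(u^m_i)^*u^n_j$ and $(\mathsf N^n_m)^i_j=u^i_m(u^j_n)^*$, and for complex coefficients $c^m_n$ put $\mathsf P=\sum_{m,n}c^m_n\mathsf M^n_m$ and $\mathsf Q=\sum_{m,n}c^m_n\mathsf N^n_m$. Then: 1) all entries of $\mathsf P$ belong to $\mathbb C_q[T\backslash G]$ if and only if $c^m_n=0$ whenever $\lambda_m\neq\lambda_n$; 2) all entries of $\mathsf Q$ belong to $\mathbb C_q[G/T]$ if and only if $c^m_n=0$ whenever $\lambda_m\neq\lambda_n$. -/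

import Mathlib

open scoped TensorProduct

noncomputable section

namespace QuantumGroup

/-- The symmetric `q`-integer `[n]_p = (p ^ n - p ^ (-n)) / (p - p⁻¹)`. -/
def qInt (p : ℂ) (n : ℕ) : ℂ := (p ^ n - p⁻¹ ^ n) / (p - p⁻¹)

/-- The `q`-factorial `[n]_p! = [1]_p [2]_p ⋯ [n]_p`. -/
def qFact (p : ℂ) (n : ℕ) : ℂ := ∏ k ∈ Finset.range n, qInt p (k + 1)

/-- The `q`-binomial coefficient `[n]_p! / ([r]_p! [n - r]_p!)`, and `0` for `r > n`. -/
def qBinom (p : ℂ) (n r : ℕ) : ℂ :=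
  if r ≤ n then qFact p n / (qFact p r * qFact p (n - r)) else 0

/-- The quantum Serre expression `∑ (-1)^r [N choose r]_p e^(N-r) f e^r`. -/
def serreSum {A : Type*} [Ring A] [Algebra ℂ A] (p : ℂ) (N : ℕ) (e f : A) : A :=
  ∑ r ∈ Finset.range (N + 1), ((-1) ^ r * qBinom p N r) • (e ^ (N - r) * f * e ^ r)

section Serre

/-- The `q`-integers `[n]_p` with `n > 0` do not vanish. -/
def Generic (p : ℂ) : Prop := p ≠ 0 ∧ ∀ n, qInt p (n + 1) ≠ 0

theorem Generic.sub_ne {p : ℂ} (h : Generic p) : p - p⁻¹ ≠ 0 := by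
  intro h0
  exact h.2 0 (by simp [qInt, h0])

theorem qInt_inv (p : ℂ) (n : ℕ) : qInt p⁻¹ n = qInt p n := by
  unfold qInt
  rw [inv_inv, ← neg_sub (p ^ n), ← neg_sub p, neg_div_neg_eq]

theorem qBinom_inv (p : ℂ) (n r : ℕ) : qBinom p⁻¹ n r = qBinom p n r := by
  simp [qBinom, qFact, qInt_inv]

theorem Generic.inv {p : ℂ} (h : Generic p) : Generic p⁻¹ :=
  ⟨inv_ne_zero h.1, fun n => by rw [qInt_inv]; exact h.2 n⟩

theorem Generic.qFact_ne {p : ℂ} (h : Generic p) (n : ℕ) : qFact p n ≠ 0 :=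
  Finset.prod_ne_zero_iff.mpr fun k _ => h.2 k

theorem qBinom_zero {p : ℂ} (h : Generic p) (n : ℕ) : qBinom p n 0 = 1 := by
  rw [qBinom, if_pos (Nat.zero_le n), Nat.sub_zero, show qFact p 0 = 1 by simp [qFact], one_mul,
    div_self (h.qFact_ne n)]

theorem qBinom_self {p : ℂ} (h : Generic p) (n : ℕ) : qBinom p n n = 1 := by
  rw [qBinom, if_pos le_rfl, Nat.sub_self, show qFact p 0 = 1 by simp [qFact], mul_one,
    div_self (h.qFact_ne n)]

theorem qBinom_symm (p : ℂ) {n r : ℕ} (hr : r ≤ n) : qBinom p n (n - r) = qBinom p n r := by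
  simp [qBinom, hr, Nat.sub_sub_self hr, mul_comm]

theorem qFact_succ (p : ℂ) (n : ℕ) : qFact p (n + 1) = qFact p n * qInt p (n + 1) := by
  simp [qFact, Finset.prod_range_succ]

theorem qInt_add {p : ℂ} (h : Generic p) (m n : ℕ) :
    qInt p (m + n) = p ^ m * qInt p n + p⁻¹ ^ n * qInt p m := by
  have h1 := h.sub_ne
  have h0 := h.1
  unfold qInt
  rw [← mul_div_assoc, ← mul_div_assoc, ← add_div]
  congr 1
  have e1 : p ^ m * p⁻¹ ^ m = 1 := by rw [← mul_pow, mul_inv_cancel₀ h0, one_pow]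
  have e2 : p ^ n * p⁻¹ ^ n = 1 := by rw [← mul_pow, mul_inv_cancel₀ h0, one_pow]
  ring

theorem qBinom_pascal {p : ℂ} (h : Generic p) {n r : ℕ} (hr : r ≤ n) :
    qBinom p (n + 1) (r + 1) =
      p ^ (r + 1) * qBinom p n (r + 1) + p⁻¹ ^ (n - r) * qBinom p n r := by
  obtain ⟨k, rfl⟩ := Nat.exists_eq_add_of_le hr
  cases k with
  | zero => 
    simp only [add_zero, qBinom_self h]
    simp [qBinom]
  | succ k =>
    have e1 : r + (k + 1) + 1 - (r + 1) = k + 1 := by omega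
    have e2 : r + (k + 1) - (r + 1) = k := by omega
    have e3 : r + (k + 1) - r = k + 1 := by omega
    have l1 : r + 1 ≤ r + (k + 1) + 1 := by omega
    have l2 : r + 1 ≤ r + (k + 1) := by omega
    have l3 : r ≤ r + (k + 1) := by omega
    simp only [qBinom, if_pos l1, if_pos l2, if_pos l3, e1, e2, e3]
    have a1 := h.qFact_ne r
    have a2 := h.qFact_ne k
    have a3 := h.2 r
    have a4 := h.2 k
    rw [qFact_succ p (r + (k + 1)), qFact_succ p r, qFact_succ p k,
      show r + (k + 1) + 1 = (r + 1) + (k + 1) by omega, qInt_add h (r + 1) (k + 1)]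
    field_simp

variable {A : Type*} [Ring A] [Algebra ℂ A]

/-- Serre expressions with an additional parameter `s`. -/
def serreAux (p s : ℂ) (N : ℕ) (e f : A) : A :=
  ∑ r ∈ Finset.range (N + 1), ((-1) ^ r * qBinom p N r * s ^ r) • (e ^ (N - r) * f * e ^ r)

theorem serreSum_eq_aux (p : ℂ) (N : ℕ) (e f : A) : serreSum p N e f = serreAux p 1 N e f := by
  simp [serreSum, serreAux]

theorem serreAux_inv (p s : ℂ) (N : ℕ) (e f : A) :
    serreAux p⁻¹ s N e f = serreAux p s N e f := by
  simp [serreAux, qBinom_inv]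

theorem serreAux_zero {p : ℂ} (h : Generic p) (s : ℂ) (e f : A) : serreAux p s 0 e f = f := by
  simp [serreAux, qBinom_zero h]

theorem serreAux_succ {p : ℂ} (h : Generic p) (s : ℂ) (N : ℕ) (e f : A) :
    serreAux p s (N + 1) e f = e * serreAux p (s * p) N e f
      - (s * p⁻¹ ^ N) • (serreAux p (s * p) N e f * e) := by
  have h0 := h.1
  have t1 : e * serreAux p (s * p) N e f =
      ∑ r ∈ Finset.range (N + 1 + 1),
        ((-1) ^ r * qBinom p N r * (s * p) ^ r) • (e ^ (N + 1 - r) * f * e ^ r) := by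
    rw [Finset.sum_range_succ, show qBinom p N (N + 1) = 0 by simp [qBinom]]
    simp only [mul_zero, zero_mul, zero_smul, add_zero, serreAux, Finset.mul_sum]
    refine Finset.sum_congr rfl fun r hr => ?_
    have : r ≤ N := by simpa [Nat.lt_succ_iff] using hr
    rw [mul_smul_comm, Nat.succ_sub this, pow_succ']
    simp only [mul_assoc]
  have t2 : (s * p⁻¹ ^ N) • (serreAux p (s * p) N e f * e) =
      ∑ r ∈ Finset.range (N + 1),
        ((s * p⁻¹ ^ N) * ((-1) ^ r * qBinom p N r * (s * p) ^ r)) •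
          (e ^ (N - r) * f * e ^ (r + 1)) := by
    simp only [serreAux, Finset.sum_mul, Finset.smul_sum]
    refine Finset.sum_congr rfl fun r hr => ?_
    rw [smul_mul_assoc, smul_smul, pow_succ, mul_assoc (e ^ (N - r) * f)]
  rw [t1, t2, Finset.sum_range_succ', serreAux, Finset.sum_range_succ', add_sub_right_comm,
    ← Finset.sum_sub_distrib]
  congr 1
  · refine Finset.sum_congr rfl fun r hr => ?_
    have hr' : r ≤ N := by simpa [Nat.lt_succ_iff] using hr
    rw [Nat.add_sub_add_right, ← sub_smul, qBinom_pascal h hr']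
    congr 1
    have : p⁻¹ ^ (N - r) = p⁻¹ ^ N * p ^ r := by
      rw [inv_pow, inv_pow]
      field_simp
      rw [← pow_add, Nat.sub_add_cancel hr']
    rw [this]
    ring
  · simp [qBinom_zero h]

/-- If `y x = p⁻² x y` and `y z = t z y` with `t = s p^N`, then `y` drops out of the shifted
Serre expression of length `N + 1`. -/
theorem serreAux_add {p : ℂ} (h : Generic p) {x y z : A} {t : ℂ}
    (hyx : y * x = (p⁻¹ ^ 2) • (x * y)) (hyz : y * z = t • (z * y)) (N : ℕ) :
    ∀ s : ℂ, s * p ^ N = t * p →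
      serreAux p s N (x + y) z = serreAux p s N x z ∧
      y * serreAux p s N x z = (t * p⁻¹ ^ (2 * N)) • (serreAux p s N x z * y) := by
  have h0 := h.1
  induction N with
  | zero => intro s _; simp [serreAux_zero h, hyz]
  | succ N ih =>
    intro s hs
    obtain ⟨i1, i2⟩ := ih (s * p) (by rw [← hs]; ring)
    have hc : s * p⁻¹ ^ N = t * p⁻¹ ^ (2 * N) := by
      have : s = t * p⁻¹ ^ N := by
        rw [pow_succ, ← mul_assoc] at hs
        rw [← mul_right_cancel₀ h0 hs, mul_assoc, ← mul_pow, mul_inv_cancel₀ h0, one_pow, mul_one]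
      rw [this]; ring
    rw [serreAux_succ h, serreAux_succ h, i1, hc]
    set w := serreAux p (s * p) N x z
    refine ⟨?_, ?_⟩
    · rw [add_mul, mul_add, i2, smul_add]; abel
    · rw [mul_sub, mul_smul_comm, ← mul_assoc, hyx, smul_mul_assoc, mul_assoc, i2,
        ← mul_assoc y w x, i2, smul_mul_assoc, mul_assoc w y x, hyx, sub_mul, smul_sub]
      simp only [mul_smul_comm, smul_mul_assoc, smul_smul, mul_assoc]
      congr 2 <;> ring

theorem serreSum_add {p : ℂ} (h : Generic p) {x y z : A} {M : ℕ}
    (hyx : y * x = (p⁻¹ ^ 2) • (x * y)) (hyz : y * z = (p ^ M) • (z * y)) :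
    serreSum p (M + 1) (x + y) z = serreSum p (M + 1) x z := by
  rw [serreSum_eq_aux, serreSum_eq_aux]
  exact (serreAux_add h hyx hyz (M + 1) 1 (by ring)).1

theorem serreSum_inv (p : ℂ) (N : ℕ) (e f : A) : serreSum p⁻¹ N e f = serreSum p N e f := by
  simp [serreSum, qBinom_inv]

theorem serreSum_add_add {p : ℂ} (h : Generic p) {x y x' y' : A} {M : ℕ}
    (hyx : y * x = (p⁻¹ ^ 2) • (x * y)) (hyz : y * x' = (p ^ M) • (x' * y))
    (hxz : x * y' = (p⁻¹ ^ M) • (y' * x)) :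
    serreSum p (M + 1) (x + y) (x' + y') =
      serreSum p (M + 1) x x' + serreSum p (M + 1) y y' := by
  have e : serreSum p (M + 1) (x + y) (x' + y') =
      serreSum p (M + 1) (x + y) x' + serreSum p (M + 1) (x + y) y' := by
    simp only [serreSum, ← Finset.sum_add_distrib, ← smul_add, mul_add, add_mul]
  have hxy : x * y = (p⁻¹⁻¹ ^ 2) • (y * x) := by
    rw [hyx, smul_smul, ← mul_pow, inv_mul_cancel₀ (inv_ne_zero h.1), one_pow, one_smul]
  rw [e, serreSum_add h hyx hyz, add_comm x y, ← serreSum_inv p (M + 1) (y + x),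
    serreSum_add h.inv hxy hxz, serreSum_inv]

/-- Serre expressions in `e k`, `f k'` for elements `k`, `k'` that commute up to scalars with
`e`, `f`. -/
theorem serreAux_twist {p : ℂ} (h : Generic p) {e f k k' : A} {α β : ℂ}
    (hke : k * e = α • (e * k)) (hkf : k * f = β • (f * k)) (hk'e : k' * e = β • (e * k'))
    (hkk : k * k' = k' * k) (N : ℕ) : ∃ γ : ℂ, ∀ s : ℂ,
      serreAux p s N (e * k) (f * k') = γ • (serreAux p s N e f * (k ^ N * k')) ∧
      k * serreAux p s N e f = (α ^ N * β) • (serreAux p s N e f * k) := by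
  induction N with
  | zero => exact ⟨1, fun s => by simp [serreAux_zero h, hkf]⟩
  | succ N ih =>
    obtain ⟨γ, ih⟩ := ih
    have hkN : ∀ n : ℕ, k ^ n * e = (α ^ n) • (e * k ^ n) := by
      intro n
      induction n with
      | zero => simp
      | succ n ihn =>
        rw [pow_succ, mul_assoc, hke, mul_smul_comm, ← mul_assoc, ihn, smul_mul_assoc, smul_smul,
          mul_assoc]
        congr 1; ring
    have hcomm : k ^ N * k' * k = k ^ (N + 1) * k' := by
      rw [mul_assoc, ← hkk, ← mul_assoc, ← pow_succ]
    refine ⟨γ * (α ^ N * β), fun s => ?_⟩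
    obtain ⟨i1, i2⟩ := ih (s * p)
    rw [serreAux_succ h, serreAux_succ h, i1]
    set w := serreAux p (s * p) N e f
    constructor
    · have a1 : e * k * (w * (k ^ N * k')) = (α ^ N * β) • (e * w * (k ^ (N + 1) * k')) := by
        rw [mul_assoc e k, ← mul_assoc k w, i2, smul_mul_assoc, mul_smul_comm]
        simp only [mul_assoc, pow_succ']
      have a2 : w * (k ^ N * k') * (e * k) = (α ^ N * β) • (w * e * (k ^ (N + 1) * k')) := by
        rw [mul_assoc w, mul_assoc (k ^ N), ← mul_assoc k' e, hk'e, smul_mul_assoc, mul_smul_comm,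
          mul_assoc e, ← mul_assoc (k ^ N), hkN, smul_mul_assoc, smul_smul, mul_smul_comm,
          ← hcomm, mul_comm β]
        simp only [mul_assoc]
      rw [mul_smul_comm, a1, smul_mul_assoc, a2, sub_mul, smul_mul_assoc, smul_sub]
      simp only [smul_smul]
      congr 2; ring
    · rw [mul_sub, mul_smul_comm, ← mul_assoc, hke, smul_mul_assoc, mul_assoc, i2,
        ← mul_assoc k w e, i2, smul_mul_assoc, mul_assoc w k e, hke, sub_mul, smul_sub]
      simp only [mul_smul_comm, smul_mul_assoc, smul_smul, mul_assoc]
      congr 2 <;> ring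

theorem serreSum_twist {p : ℂ} (h : Generic p) {e f k k' : A} {α β : ℂ} {N : ℕ}
    (hke : k * e = α • (e * k)) (hkf : k * f = β • (f * k)) (hk'e : k' * e = β • (e * k'))
    (hkk : k * k' = k' * k) (h0 : serreSum p N e f = 0) :
    serreSum p N (e * k) (f * k') = 0 := by
  obtain ⟨γ, hγ⟩ := serreAux_twist h hke hkf hk'e hkk N
  rw [serreSum_eq_aux] at h0 ⊢
  rw [(hγ 1).1, h0, zero_mul, smul_zero]

theorem serreSum_smul (p c c' : ℂ) (N : ℕ) (e f : A) :
    serreSum p N (c • e) (c' • f) = (c ^ N * c') • serreSum p N e f := by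
  simp only [serreSum, Finset.smul_sum]
  refine Finset.sum_congr rfl fun r hr => ?_
  have hr' : r ≤ N := by simpa [Nat.lt_succ_iff] using hr
  simp only [smul_pow, smul_mul_assoc, mul_smul_comm, smul_smul]
  congr 1
  have : c ^ N = c ^ (N - r) * c ^ r := by rw [← pow_add, Nat.sub_add_cancel hr']
  rw [this]; ring

theorem serreSum_op (p : ℂ) (N : ℕ) (e f : A) :
    serreSum p N (MulOpposite.op e) (MulOpposite.op f) =
      ((-1 : ℂ) ^ N) • MulOpposite.op (serreSum p N e f) := by
  unfold serreSum
  rw [← Finset.sum_range_reflect, ← MulOpposite.op_smul, Finset.smul_sum, Finset.op_sum]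
  refine Finset.sum_congr rfl fun r hr => ?_
  have hr' : r ≤ N := by simpa [Nat.lt_succ_iff] using hr
  have e1 : N + 1 - 1 - r = N - r := by omega
  have e2 : N - (N - r) = r := by omega
  rw [e1, e2, qBinom_symm p hr', ← MulOpposite.op_pow, ← MulOpposite.op_pow,
    ← MulOpposite.op_mul, ← MulOpposite.op_mul, ← MulOpposite.op_smul, smul_smul, mul_assoc]
  congr 2
  have : (-1 : ℂ) ^ N = (-1) ^ (N - r) * (-1) ^ r := by rw [← pow_add, Nat.sub_add_cancel hr']
  rw [this]
  have : (-1 : ℂ) ^ r * (-1) ^ r = 1 := by rw [← mul_pow]; simp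
  linear_combination (-(-1 : ℂ) ^ (N - r) * qBinom p N r) * this

theorem map_serreSum {B : Type*} [Ring B] [Algebra ℂ B] (g : A →ₐ[ℂ] B) (p : ℂ) (N : ℕ)
    (e f : A) : g (serreSum p N e f) = serreSum p N (g e) (g f) := by
  simp [serreSum, map_sum]

theorem serreSum_tmul_left {B : Type*} [Ring B] [Algebra ℂ B] (p : ℂ) (N : ℕ) (e f : A)
    {k k' : B} (hk : k * k' = k' * k) :
    serreSum p N (e ⊗ₜ[ℂ] k) (f ⊗ₜ[ℂ] k') = serreSum p N e f ⊗ₜ[ℂ] (k ^ N * k') := by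
  simp only [serreSum, TensorProduct.sum_tmul]
  refine Finset.sum_congr rfl fun r hr => ?_
  have hr' : r ≤ N := by simpa [Nat.lt_succ_iff] using hr
  have : k ^ (N - r) * k' * k ^ r = k ^ N * k' := by
    have c : Commute k k' := hk
    rw [mul_assoc, ← (c.pow_left r).eq, ← mul_assoc, ← pow_add, Nat.sub_add_cancel hr']
  simp only [Algebra.TensorProduct.tmul_pow, Algebra.TensorProduct.tmul_mul_tmul,
    TensorProduct.smul_tmul', this]

theorem serreSum_tmul_right {B : Type*} [Ring B] [Algebra ℂ B] (p : ℂ) (N : ℕ) (e f : A)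
    {k k' : B} (hk : k * k' = k' * k) :
    serreSum p N (k ⊗ₜ[ℂ] e) (k' ⊗ₜ[ℂ] f) = (k ^ N * k') ⊗ₜ[ℂ] serreSum p N e f := by
  simp only [serreSum, TensorProduct.tmul_sum]
  refine Finset.sum_congr rfl fun r hr => ?_
  have hr' : r ≤ N := by simpa [Nat.lt_succ_iff] using hr
  have : k ^ (N - r) * k' * k ^ r = k ^ N * k' := by
    have c : Commute k k' := hk
    rw [mul_assoc, ← (c.pow_left r).eq, ← mul_assoc, ← pow_add, Nat.sub_add_cancel hr']
  simp only [Algebra.TensorProduct.tmul_pow, Algebra.TensorProduct.tmul_mul_tmul,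
    TensorProduct.tmul_smul, this]

end Serre

/-! ### Cartan data and the quantized enveloping algebra -/

/-- A (symmetrized) Cartan matrix `a` with `d i * a i j = d j * a j i`, together with a
deformation parameter `q > 0`, `q ≠ 1`. -/
structure Datum (ι : Type*) where
  a : ι → ι → ℤ
  d : ι → ℝ
  q : ℝ
  a_diag : ∀ i, a i i = 2
  a_nonpos : ∀ i j, i ≠ j → a i j ≤ 0
  d_pos : ∀ i, 0 < d i
  d_symm : ∀ i j, d i * a i j = d j * a j i
  q_pos : 0 < q
  q_ne_one : q ≠ 1

/-- The generators of the quantized enveloping algebra; `Kinv i` stands for `K_i⁻¹`. -/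
inductive Gen (ι : Type*) where
  | E (i : ι) : Gen ι
  | F (i : ι) : Gen ι
  | K (i : ι) : Gen ι
  | Kinv (i : ι) : Gen ι

namespace Datum

variable {ι : Type*} (D : Datum ι)

/-- `q_i = q ^ d_i`, as a complex number. -/
def qi (i : ι) : ℂ := ((D.q ^ D.d i : ℝ) : ℂ)

/-- The relations of the generators in an algebra. -/
structure Realizes {A : Type*} [Ring A] [Algebra ℂ A] (E F K L : ι → A) : Prop where
  K_mul_L : ∀ i, K i * L i = 1
  L_mul_K : ∀ i, L i * K i = 1
  K_comm : ∀ i j, K i * K j = K j * K i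
  K_E_L : ∀ i j, K i * E j * L i = (D.qi i ^ D.a i j) • E j
  K_F_L : ∀ i j, K i * F j * L i = (D.qi i ^ (-D.a i j)) • F j
  E_F_same : ∀ i, E i * F i - F i * E i = (D.qi i - (D.qi i)⁻¹)⁻¹ • (K i - L i)
  E_F_ne : ∀ i j, i ≠ j → E i * F j - F j * E i = 0
  serre_E : ∀ i j, i ≠ j → serreSum (D.qi i) (1 - D.a i j).toNat (E i) (E j) = 0
  serre_F : ∀ i j, i ≠ j → serreSum (D.qi i) (1 - D.a i j).toNat (F i) (F j) = 0

open Gen in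
/-- The defining relations of the quantized enveloping algebra, on the free algebra on the
generators. -/
inductive Rel : FreeAlgebra ℂ (Gen ι) → FreeAlgebra ℂ (Gen ι) → Prop
  | K_mul_L (i) : Rel (.ι ℂ (K i) * .ι ℂ (Kinv i)) 1
  | L_mul_K (i) : Rel (.ι ℂ (Kinv i) * .ι ℂ (K i)) 1
  | K_comm (i j) : Rel (.ι ℂ (K i) * .ι ℂ (K j)) (.ι ℂ (K j) * .ι ℂ (K i))
  | K_E_L (i j) : Rel (.ι ℂ (K i) * .ι ℂ (E j) * .ι ℂ (Kinv i)) ((D.qi i ^ D.a i j) • .ι ℂ (E j))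
  | K_F_L (i j) :
      Rel (.ι ℂ (K i) * .ι ℂ (F j) * .ι ℂ (Kinv i)) ((D.qi i ^ (-D.a i j)) • .ι ℂ (F j))
  | E_F_same (i) : Rel (.ι ℂ (E i) * .ι ℂ (F i) - .ι ℂ (F i) * .ι ℂ (E i))
      ((D.qi i - (D.qi i)⁻¹)⁻¹ • (.ι ℂ (K i) - .ι ℂ (Kinv i)))
  | E_F_ne (i j) (h : i ≠ j) : Rel (.ι ℂ (E i) * .ι ℂ (F j) - .ι ℂ (F j) * .ι ℂ (E i)) 0
  | serre_E (i j) (h : i ≠ j) :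
      Rel (serreSum (D.qi i) (1 - D.a i j).toNat (.ι ℂ (E i)) (.ι ℂ (E j))) 0
  | serre_F (i j) (h : i ≠ j) :
      Rel (serreSum (D.qi i) (1 - D.a i j).toNat (.ι ℂ (F i)) (.ι ℂ (F j))) 0

/-- The quantized universal enveloping algebra `U_q(𝔤)`. -/
def U : Type _ := RingQuot D.Rel

instance : Ring D.U := inferInstanceAs (Ring (RingQuot D.Rel))

instance : Algebra ℂ D.U := inferInstanceAs (Algebra ℂ (RingQuot D.Rel))

/-- The quotient map from the free algebra. -/
def proj : FreeAlgebra ℂ (Gen ι) →ₐ[ℂ] D.U := RingQuot.mkAlgHom ℂ D.Rel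

theorem proj_rel {x y : FreeAlgebra ℂ (Gen ι)} (h : D.Rel x y) : D.proj x = D.proj y :=
  RingQuot.mkAlgHom_rel ℂ h

/-- The image of a generator in `U_q(𝔤)`. -/
def gen (x : Gen ι) : D.U := D.proj (FreeAlgebra.ι ℂ x)

def E (i : ι) : D.U := D.gen (.E i)
def F (i : ι) : D.U := D.gen (.F i)
def K (i : ι) : D.U := D.gen (.K i)
def Kinv (i : ι) : D.U := D.gen (.Kinv i)

theorem realizes_U : D.Realizes D.E D.F D.K D.Kinv := by
  constructor <;> intros <;>
    simp only [E, F, K, Kinv, gen, ← map_mul, ← map_smul, ← map_sub, ← map_serreSum]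
  · rw [← map_one D.proj]; exact D.proj_rel (.K_mul_L _)
  · rw [← map_one D.proj]; exact D.proj_rel (.L_mul_K _)
  · exact D.proj_rel (.K_comm _ _)
  · exact D.proj_rel (.K_E_L _ _)
  · exact D.proj_rel (.K_F_L _ _)
  · exact D.proj_rel (.E_F_same _)
  · rw [← map_zero D.proj]
    exact D.proj_rel (.E_F_ne _ _ (by assumption))
  · rw [← map_zero D.proj]
    exact D.proj_rel (.serre_E _ _ (by assumption))
  · rw [← map_zero D.proj]
    exact D.proj_rel (.serre_F _ _ (by assumption))

section Lift

variable {D} {A : Type*} [Ring A] [Algebra ℂ A] {E F K L : ι → A}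

/-- The values on the generators of the homomorphism given by a realization. -/
def genMap (E F K L : ι → A) : Gen ι → A
  | .E i => E i
  | .F i => F i
  | .K i => K i
  | .Kinv i => L i

/-- The universal property of `U_q(𝔤)`: the algebra homomorphism with prescribed values on
the generators. -/
def lift (h : D.Realizes E F K L) : D.U →ₐ[ℂ] A :=
  RingQuot.liftAlgHom ℂ ⟨FreeAlgebra.lift ℂ (genMap E F K L), by
    intro x y hxy
    cases hxy <;> simp only [map_mul, map_smul, map_sub, map_one, map_zero, map_serreSum,
      FreeAlgebra.lift_ι_apply, genMap]
    · exact h.K_mul_L _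
    · exact h.L_mul_K _
    · exact h.K_comm _ _
    · exact h.K_E_L _ _
    · exact h.K_F_L _ _
    · exact h.E_F_same _
    · exact h.E_F_ne _ _ (by assumption)
    · exact h.serre_E _ _ (by assumption)
    · exact h.serre_F _ _ (by assumption)⟩

theorem lift_gen (h : D.Realizes E F K L) (x : Gen ι) :
    lift h (D.gen x) = genMap E F K L x := by
  have : lift h (D.gen x) = FreeAlgebra.lift ℂ (genMap E F K L) (FreeAlgebra.ι ℂ x) :=
    RingQuot.liftAlgHom_mkAlgHom_apply ..
  rw [this, FreeAlgebra.lift_ι_apply]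

end Lift

section Facts

theorem qi_ne (i : ι) : D.qi i ≠ 0 := by
  simpa [qi] using (Real.rpow_pos_of_pos D.q_pos _).ne'

theorem qInt_ofReal_ne {p : ℝ} (hp : 0 < p) (h1 : p ≠ 1) (n : ℕ) : qInt (p : ℂ) (n + 1) ≠ 0 := by
  have key : ∀ m : ℕ, p ^ (m + 1) - p⁻¹ ^ (m + 1) ≠ 0 := by
    intro m h
    have h2 : p ^ (m + 1) * p ^ (m + 1) = 1 := by
      nth_rewrite 2 [sub_eq_zero.mp h]
      rw [← mul_pow, mul_inv_cancel₀ hp.ne', one_pow]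
    rw [← pow_add] at h2
    exact h1 ((pow_eq_one_iff_of_nonneg hp.le (by omega)).mp h2)
  have e : qInt (p : ℂ) (n + 1) =
      (((p ^ (n + 1) - p⁻¹ ^ (n + 1)) / (p ^ (0 + 1) - p⁻¹ ^ (0 + 1)) : ℝ) : ℂ) := by
    simp [qInt]
  rw [e]
  exact_mod_cast div_ne_zero (key n) (key 0)

theorem generic_qi (i : ι) : Generic (D.qi i) := by
  refine ⟨D.qi_ne i, fun n => qInt_ofReal_ne (Real.rpow_pos_of_pos D.q_pos _) ?_ n⟩
  intro h
  have h' := congrArg Real.log h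
  rw [Real.log_rpow D.q_pos, Real.log_one] at h'
  rcases mul_eq_zero.mp h' with h' | h'
  · exact (D.d_pos i).ne' h'
  · exact D.q_ne_one (Real.eq_one_of_pos_of_log_eq_zero D.q_pos h')

theorem qi_zpow_symm (i j : ι) : D.qi i ^ D.a i j = D.qi j ^ D.a j i := by
  simp only [qi]
  norm_cast
  rw [← Real.rpow_intCast, ← Real.rpow_intCast, ← Real.rpow_mul D.q_pos.le,
    ← Real.rpow_mul D.q_pos.le, D.d_symm]

theorem exists_a {i j : ι} (h : i ≠ j) :
    ∃ M : ℕ, D.a i j = -(M : ℤ) ∧ (1 - D.a i j).toNat = M + 1 := by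
  obtain ⟨M, hM⟩ := Int.eq_ofNat_of_zero_le (neg_nonneg.mpr (D.a_nonpos i j h))
  exact ⟨M, by omega, by omega⟩

variable {D} {A : Type*} [Ring A] [Algebra ℂ A] {E F K L : ι → A}

namespace Realizes

theorem K_E (h : D.Realizes E F K L) (i j : ι) : K i * E j = (D.qi i ^ D.a i j) • (E j * K i) := by
  rw [← smul_mul_assoc, ← h.K_E_L, mul_assoc _ (L i), h.L_mul_K, mul_one]

theorem K_F (h : D.Realizes E F K L) (i j : ι) : K i * F j = (D.qi i ^ (-D.a i j)) • (F j * K i) := by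
  rw [← smul_mul_assoc, ← h.K_F_L, mul_assoc _ (L i), h.L_mul_K, mul_one]

theorem L_E (h : D.Realizes E F K L) (i j : ι) : L i * E j = (D.qi i ^ (-D.a i j)) • (E j * L i) := by
  have e : E j = (D.qi i ^ (-D.a i j)) • (K i * E j * L i) := by
    rw [h.K_E_L, smul_smul, ← zpow_add₀ (D.qi_ne i)]; simp
  conv_lhs => rw [e]
  rw [mul_smul_comm, ← mul_assoc, ← mul_assoc, h.L_mul_K, one_mul]

theorem L_F (h : D.Realizes E F K L) (i j : ι) : L i * F j = (D.qi i ^ D.a i j) • (F j * L i) := by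
  have e : F j = (D.qi i ^ D.a i j) • (K i * F j * L i) := by
    rw [h.K_F_L, smul_smul, ← zpow_add₀ (D.qi_ne i)]; simp
  conv_lhs => rw [e]
  rw [mul_smul_comm, ← mul_assoc, ← mul_assoc, h.L_mul_K, one_mul]

theorem K_L_comm (h : D.Realizes E F K L) (i j : ι) : K i * L j = L j * K i := by
  calc K i * L j = L j * (K j * K i) * L j := by
        rw [← mul_assoc (L j), h.L_mul_K, one_mul]
    _ = L j * K i := by rw [h.K_comm j i, mul_assoc, mul_assoc, h.K_mul_L, mul_one]

theorem L_comm (h : D.Realizes E F K L) (i j : ι) : L i * L j = L j * L i := by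
  calc L i * L j = L i * (L j * K i) * L i := by
        rw [mul_assoc (L i), mul_assoc (L j), h.K_mul_L, mul_one]
    _ = L j * L i := by rw [← h.K_L_comm, ← mul_assoc, h.L_mul_K, one_mul]

end Realizes

end Facts

section Hopf

/-- `Δ(K_i) = K_i ⊗ K_i`, `Δ(E_i) = E_i ⊗ K_i + 1 ⊗ E_i`, `Δ(F_i) = F_i ⊗ 1 + K_i⁻¹ ⊗ F_i`
satisfy the defining relations. -/
theorem realizes_comul : D.Realizes
    (fun i => D.E i ⊗ₜ[ℂ] D.K i + 1 ⊗ₜ[ℂ] D.E i)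
    (fun i => D.F i ⊗ₜ[ℂ] 1 + D.Kinv i ⊗ₜ[ℂ] D.F i)
    (fun i => D.K i ⊗ₜ[ℂ] D.K i) (fun i => D.Kinv i ⊗ₜ[ℂ] D.Kinv i) := by
  have h := D.realizes_U
  have hE : ∀ i j, (1 ⊗ₜ[ℂ] D.E i : D.U ⊗[ℂ] D.U) * (D.E j ⊗ₜ[ℂ] D.K j) =
      (D.qi i ^ (-D.a i j)) • ((D.E j ⊗ₜ[ℂ] D.K j) * (1 ⊗ₜ[ℂ] D.E i)) := by
    intro i j
    rw [Algebra.TensorProduct.tmul_mul_tmul, Algebra.TensorProduct.tmul_mul_tmul, h.K_E,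
      D.qi_zpow_symm j i, TensorProduct.tmul_smul, smul_smul, ← zpow_add₀ (D.qi_ne i)]
    simp
  have hF : ∀ i j, (D.F i ⊗ₜ[ℂ] 1 : D.U ⊗[ℂ] D.U) * (D.Kinv j ⊗ₜ[ℂ] D.F j) =
      (D.qi i ^ (-D.a i j)) • ((D.Kinv j ⊗ₜ[ℂ] D.F j) * (D.F i ⊗ₜ[ℂ] 1)) := by
    intro i j
    rw [Algebra.TensorProduct.tmul_mul_tmul, Algebra.TensorProduct.tmul_mul_tmul, h.L_F,
      D.qi_zpow_symm j i, ← TensorProduct.smul_tmul', smul_smul, ← zpow_add₀ (D.qi_ne i)]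
    simp
  have flip : ∀ (i j : ι) (x y : D.U ⊗[ℂ] D.U) , x * y = (D.qi i ^ (-D.a i j)) • (y * x) →
      y * x = (D.qi i ^ (D.a i j)) • (x * y) := by
    intro i j x y hxy
    rw [hxy, smul_smul, ← zpow_add₀ (D.qi_ne i)]; simp
  constructor
  · intro i; simp [h.K_mul_L, Algebra.TensorProduct.one_def]
  · intro i; simp [h.L_mul_K, Algebra.TensorProduct.one_def]
  · intro i j; simp [h.K_comm i j]
  · intro i j
    simp only [mul_add, add_mul, Algebra.TensorProduct.tmul_mul_tmul, h.K_E_L, mul_one,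
      h.K_mul_L, h.K_comm i j, smul_add, TensorProduct.smul_tmul', TensorProduct.tmul_smul]
    simp only [mul_assoc, h.K_mul_L, mul_one]
  · intro i j
    simp only [mul_add, add_mul, Algebra.TensorProduct.tmul_mul_tmul, h.K_F_L, mul_one,
      h.K_mul_L, h.K_L_comm i j, smul_add, TensorProduct.smul_tmul', TensorProduct.tmul_smul]
    simp only [mul_assoc, h.K_mul_L, mul_one]
  · intro i
    have e1 := flip i i _ _ (hE i i)
    have e2 := hF i i
    have c1 : (D.E i ⊗ₜ[ℂ] D.K i : D.U ⊗[ℂ] D.U) * (D.Kinv i ⊗ₜ[ℂ] D.F i) =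
        (D.Kinv i ⊗ₜ[ℂ] D.F i) * (D.E i ⊗ₜ[ℂ] D.K i) := by
      rw [Algebra.TensorProduct.tmul_mul_tmul, Algebra.TensorProduct.tmul_mul_tmul, h.K_F, h.L_E,
        TensorProduct.tmul_smul, ← TensorProduct.smul_tmul']
    have c2 : (1 ⊗ₜ[ℂ] D.E i : D.U ⊗[ℂ] D.U) * (D.F i ⊗ₜ[ℂ] 1) =
        (D.F i ⊗ₜ[ℂ] 1) * (1 ⊗ₜ[ℂ] D.E i) := by simp
    have s1 : (D.E i ⊗ₜ[ℂ] D.K i : D.U ⊗[ℂ] D.U) * (D.F i ⊗ₜ[ℂ] 1) -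
        (D.F i ⊗ₜ[ℂ] 1) * (D.E i ⊗ₜ[ℂ] D.K i) =
        (D.qi i - (D.qi i)⁻¹)⁻¹ • ((D.K i - D.Kinv i) ⊗ₜ[ℂ] D.K i) := by
      rw [TensorProduct.smul_tmul', ← h.E_F_same, TensorProduct.sub_tmul]; simp
    have s2 : (1 ⊗ₜ[ℂ] D.E i : D.U ⊗[ℂ] D.U) * (D.Kinv i ⊗ₜ[ℂ] D.F i) -
        (D.Kinv i ⊗ₜ[ℂ] D.F i) * (1 ⊗ₜ[ℂ] D.E i) =
        (D.qi i - (D.qi i)⁻¹)⁻¹ • (D.Kinv i ⊗ₜ[ℂ] (D.K i - D.Kinv i)) := by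
      rw [← TensorProduct.tmul_smul, ← h.E_F_same, TensorProduct.tmul_sub]; simp
    have t : (D.K i ⊗ₜ[ℂ] D.K i - D.Kinv i ⊗ₜ[ℂ] D.Kinv i : D.U ⊗[ℂ] D.U) =
        (D.K i - D.Kinv i) ⊗ₜ[ℂ] D.K i + D.Kinv i ⊗ₜ[ℂ] (D.K i - D.Kinv i) := by
      rw [TensorProduct.sub_tmul, TensorProduct.tmul_sub]; abel
    rw [t, smul_add, ← s1, ← s2, mul_add, add_mul, add_mul, mul_add, add_mul, add_mul, c1, c2]
    abel
  · intro i j hij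
    have c1 : (D.E i ⊗ₜ[ℂ] D.K i : D.U ⊗[ℂ] D.U) * (D.Kinv j ⊗ₜ[ℂ] D.F j) =
        (D.Kinv j ⊗ₜ[ℂ] D.F j) * (D.E i ⊗ₜ[ℂ] D.K i) := by
      rw [Algebra.TensorProduct.tmul_mul_tmul, Algebra.TensorProduct.tmul_mul_tmul, h.K_F, h.L_E,
        TensorProduct.tmul_smul, ← TensorProduct.smul_tmul', zpow_neg, zpow_neg,
        D.qi_zpow_symm i j]
    have c2 : (1 ⊗ₜ[ℂ] D.E i : D.U ⊗[ℂ] D.U) * (D.F j ⊗ₜ[ℂ] 1) =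
        (D.F j ⊗ₜ[ℂ] 1) * (1 ⊗ₜ[ℂ] D.E i) := by simp
    have s1 : (D.E i ⊗ₜ[ℂ] D.K i : D.U ⊗[ℂ] D.U) * (D.F j ⊗ₜ[ℂ] 1) -
        (D.F j ⊗ₜ[ℂ] 1) * (D.E i ⊗ₜ[ℂ] D.K i) = 0 := by
      rw [Algebra.TensorProduct.tmul_mul_tmul, Algebra.TensorProduct.tmul_mul_tmul, mul_one,
        one_mul, ← TensorProduct.sub_tmul, h.E_F_ne i j hij, TensorProduct.zero_tmul]
    have s2 : (1 ⊗ₜ[ℂ] D.E i : D.U ⊗[ℂ] D.U) * (D.Kinv j ⊗ₜ[ℂ] D.F j) -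
        (D.Kinv j ⊗ₜ[ℂ] D.F j) * (1 ⊗ₜ[ℂ] D.E i) = 0 := by
      rw [Algebra.TensorProduct.tmul_mul_tmul, Algebra.TensorProduct.tmul_mul_tmul, mul_one,
        one_mul, ← TensorProduct.tmul_sub, h.E_F_ne i j hij, TensorProduct.tmul_zero]
    rw [mul_add, add_mul, add_mul, mul_add, add_mul, add_mul, c1, c2, sub_eq_zero.mp s1,
      sub_eq_zero.mp s2]
    abel
  · intro i j hij
    obtain ⟨M, hM, hM'⟩ := D.exists_a hij
    have b1 := hE i i
    have b2 := hE i j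
    have b3 := hE j i
    rw [zpow_neg, ← D.qi_zpow_symm, ← zpow_neg] at b3
    replace b3 := flip i j _ _ b3
    rw [D.a_diag, zpow_neg, ← inv_zpow] at b1
    rw [hM, neg_neg, zpow_natCast] at b2
    rw [hM, zpow_neg, ← inv_zpow, zpow_natCast] at b3
    rw [hM', serreSum_add_add (D.generic_qi i) b1 b2 b3, serreSum_tmul_left _ _ _ _ (h.K_comm i j),
      serreSum_tmul_right _ _ _ _ rfl, ← hM', h.serre_E i j hij, TensorProduct.zero_tmul,
      TensorProduct.tmul_zero, add_zero]
  · intro i j hij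
    obtain ⟨M, hM, hM'⟩ := D.exists_a hij
    have b1 := hF i i
    have b2 := hF i j
    have b3 := hF j i
    rw [zpow_neg, ← D.qi_zpow_symm, ← zpow_neg] at b3
    replace b3 := flip i j _ _ b3
    rw [D.a_diag, zpow_neg, ← inv_zpow] at b1
    rw [hM, neg_neg, zpow_natCast] at b2
    rw [hM, zpow_neg, ← inv_zpow, zpow_natCast] at b3
    rw [hM', add_comm (D.F i ⊗ₜ[ℂ] 1), add_comm (D.F j ⊗ₜ[ℂ] 1),
      serreSum_add_add (D.generic_qi i) b1 b2 b3, serreSum_tmul_left _ _ _ _ rfl,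
      serreSum_tmul_right _ _ _ _ (h.L_comm i j), ← hM', h.serre_F i j hij,
      TensorProduct.zero_tmul, TensorProduct.tmul_zero, add_zero]

/-- The coproduct of `U_q(𝔤)`. -/
def comul : D.U →ₐ[ℂ] D.U ⊗[ℂ] D.U := lift D.realizes_comul

theorem EL_mul_KF (i : ι) : D.E i * D.Kinv i * (D.K i * D.F i) = D.E i * D.F i := by
  rw [mul_assoc, ← mul_assoc (D.Kinv i), D.realizes_U.L_mul_K, one_mul]

theorem KF_mul_EL (i : ι) : D.K i * D.F i * (D.E i * D.Kinv i) = D.F i * D.E i := by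
  rw [D.realizes_U.K_F, smul_mul_assoc, mul_assoc, ← mul_assoc (D.K i), D.realizes_U.K_E_L,
    mul_smul_comm, smul_smul, ← zpow_add₀ (D.qi_ne i)]
  simp

theorem KF_comm_EL {i j : ι} (hij : i ≠ j) :
    D.K j * D.F j * (D.E i * D.Kinv i) = D.E i * D.Kinv i * (D.K j * D.F j) := by
  have h := D.realizes_U
  have hEF := sub_eq_zero.mp (h.E_F_ne i j hij)
  have e1 : D.K j * D.F j * (D.E i * D.Kinv i) =
      (D.qi j ^ (-D.a j j) * D.qi j ^ (D.a j i)) • (D.F j * D.E i * (D.K j * D.Kinv i)) := by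
    rw [h.K_F, smul_mul_assoc, mul_assoc, ← mul_assoc (D.K j), h.K_E, smul_mul_assoc,
      mul_smul_comm, smul_smul]
    simp only [mul_assoc]
  have e2 : D.E i * D.Kinv i * (D.K j * D.F j) =
      (D.qi j ^ (-D.a j j) * D.qi i ^ (D.a i j)) • (D.E i * D.F j * (D.Kinv i * D.K j)) := by
    rw [h.K_F, mul_smul_comm, mul_assoc, ← mul_assoc (D.Kinv i), h.L_F, smul_mul_assoc,
      mul_smul_comm, smul_smul]
    simp only [mul_assoc]
  rw [e1, e2, hEF, h.K_L_comm, D.qi_zpow_symm i j]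

theorem serre_EL {i j : ι} (hij : i ≠ j) :
    serreSum (D.qi i) (1 - D.a i j).toNat (D.E i * D.Kinv i) (D.E j * D.Kinv j) = 0 := by
  have h := D.realizes_U
  refine serreSum_twist (D.generic_qi i) (h.L_E i i) (h.L_E i j) ?_ (h.L_comm i j)
    (h.serre_E i j hij)
  rw [h.L_E, zpow_neg, ← D.qi_zpow_symm, ← zpow_neg]

theorem serre_KF {i j : ι} (hij : i ≠ j) :
    serreSum (D.qi i) (1 - D.a i j).toNat (D.K i * D.F i) (D.K j * D.F j) = 0 := by
  have h := D.realizes_U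
  have : serreSum (D.qi i) (1 - D.a i j).toNat (D.F i * D.K i) (D.F j * D.K j) = 0 := by
    refine serreSum_twist (D.generic_qi i) (h.K_F i i) (h.K_F i j) ?_ (h.K_comm i j)
      (h.serre_F i j hij)
    rw [h.K_F, zpow_neg, ← D.qi_zpow_symm, ← zpow_neg]
  rw [h.K_F i i, h.K_F j j, serreSum_smul, this, smul_zero]

open MulOpposite in
/-- `S(K_i) = K_i⁻¹`, `S(E_i) = -E_i K_i⁻¹`, `S(F_i) = -K_i F_i` satisfy the defining relations
in the opposite algebra. -/
theorem realizes_antipode : D.Realizes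
    (fun i => op (-(D.E i * D.Kinv i))) (fun i => op (-(D.K i * D.F i)))
    (fun i => op (D.Kinv i)) (fun i => op (D.K i)) := by
  have h := D.realizes_U
  constructor
  · intro i; rw [← op_mul, h.K_mul_L, op_one]
  · intro i; rw [← op_mul, h.L_mul_K, op_one]
  · intro i j; rw [← op_mul, ← op_mul, h.L_comm]
  · intro i j
    rw [← op_mul, ← op_mul, ← op_smul]
    congr 1
    rw [neg_mul, mul_neg, smul_neg, mul_assoc (D.E j), h.L_comm, ← mul_assoc (D.E j),
      ← mul_assoc (D.K i), ← mul_assoc (D.K i), h.K_E_L, smul_mul_assoc]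
  · intro i j
    rw [← op_mul, ← op_mul, ← op_smul]
    congr 1
    rw [neg_mul, mul_neg, smul_neg, mul_assoc (D.K j), ← mul_assoc (D.K i), h.K_comm, mul_assoc,
      ← mul_assoc (D.K i), h.K_F_L, mul_smul_comm]
  · intro i
    rw [← op_mul, ← op_mul, ← op_sub, ← op_sub, ← op_smul]
    congr 1
    rw [neg_mul_neg, neg_mul_neg, EL_mul_KF, KF_mul_EL, ← neg_sub, h.E_F_same, ← smul_neg, neg_sub]
  · intro i j hij
    rw [← op_mul, ← op_mul, ← op_sub, neg_mul_neg, neg_mul_neg, D.KF_comm_EL hij, sub_self, op_zero]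
  · intro i j hij
    rw [serreSum_op, ← neg_one_smul ℂ (D.E i * _), ← neg_one_smul ℂ (D.E j * _), serreSum_smul,
      D.serre_EL hij, smul_zero, op_zero, smul_zero]
  · intro i j hij
    rw [serreSum_op, ← neg_one_smul ℂ (D.K i * _), ← neg_one_smul ℂ (D.K j * _), serreSum_smul,
      D.serre_KF hij, smul_zero, op_zero, smul_zero]

/-- The antipode of `U_q(𝔤)`. -/
def antipode : D.U →ₗ[ℂ] D.U :=
  (MulOpposite.opLinearEquiv ℂ).symm.toLinearMap ∘ₗ (lift D.realizes_antipode).toLinearMap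

open MulOpposite in
/-- `K_i^* = K_i`, `E_i^* = K_i F_i`, `F_i^* = E_i K_i⁻¹` satisfy the defining relations
in the opposite algebra. -/
theorem realizes_star : D.Realizes
    (fun i => op (D.K i * D.F i)) (fun i => op (D.E i * D.Kinv i))
    (fun i => op (D.K i)) (fun i => op (D.Kinv i)) := by
  have h := D.realizes_U
  constructor
  · intro i; rw [← op_mul, h.L_mul_K, op_one]
  · intro i; rw [← op_mul, h.K_mul_L, op_one]
  · intro i j; rw [← op_mul, ← op_mul, h.K_comm]
  · intro i j
    rw [← op_mul, ← op_mul, ← op_smul]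
    congr 1
    rw [mul_assoc (D.K j), ← mul_assoc (D.Kinv i), ← h.K_L_comm, mul_assoc, ← mul_assoc (D.Kinv i),
      h.L_F, smul_mul_assoc, mul_smul_comm, mul_assoc (D.F j), h.L_mul_K, mul_one]
  · intro i j
    rw [← op_mul, ← op_mul, ← op_smul]
    congr 1
    rw [mul_assoc (D.E j), ← h.K_L_comm, ← mul_assoc, ← mul_assoc, h.L_E, smul_mul_assoc,
      mul_assoc (D.E j), h.L_mul_K, mul_one, smul_mul_assoc]
  · intro i
    rw [← op_mul, ← op_mul, ← op_sub, ← op_sub, ← op_smul]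
    congr 1
    rw [EL_mul_KF, KF_mul_EL, h.E_F_same]
  · intro i j hij
    rw [← op_mul, ← op_mul, ← op_sub, D.KF_comm_EL hij.symm, sub_self, op_zero]
  · intro i j hij
    rw [serreSum_op, D.serre_KF hij, op_zero, smul_zero]
  · intro i j hij
    rw [serreSum_op, D.serre_EL hij, op_zero, smul_zero]

/-- The complex conjugate of an algebra: the same ring, with `c • x` replaced by `conj c • x`. -/
def ConjAlg (A : Type*) : Type _ := A

instance {A : Type*} [Ring A] : Ring (ConjAlg A) := inferInstanceAs (Ring A)

instance {A : Type*} [Ring A] [Algebra ℂ A] : Algebra ℂ (ConjAlg A) :=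
  Algebra.compHom (R := ℂ) A (starRingEnd ℂ)

theorem conj_smul_def {A : Type*} [Ring A] [Algebra ℂ A] (c : ℂ) (x : A) :
    HSMul.hSMul (β := ConjAlg A) (γ := ConjAlg A) c x = (starRingEnd ℂ c • x : A) := rfl

theorem conj_qi (i : ι) : starRingEnd ℂ (D.qi i) = D.qi i := Complex.conj_ofReal _

theorem conj_serre_coeff (i : ι) (n r : ℕ) :
    starRingEnd ℂ ((-1) ^ r * qBinom (D.qi i) n r) = (-1) ^ r * qBinom (D.qi i) n r := by
  have h : ∀ m, starRingEnd ℂ (qFact (D.qi i) m) = qFact (D.qi i) m := by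
    intro m; simp [qFact, qInt, map_prod, conj_qi]
  unfold qBinom
  split_ifs <;> simp [h]

theorem conj_serreSum {A : Type*} [Ring A] [Algebra ℂ A] (i : ι) (N : ℕ) (e f : A) :
    serreSum (A := ConjAlg A) (D.qi i) N e f = serreSum (A := A) (D.qi i) N e f := by
  unfold serreSum
  refine Finset.sum_congr rfl fun r _ => ?_
  conv_rhs => rw [← conj_serre_coeff]
  rfl

theorem Realizes.conj {A : Type*} [Ring A] [Algebra ℂ A] {E F K L : ι → A}
    (h : D.Realizes E F K L) : D.Realizes (A := ConjAlg A) E F K L where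
  K_mul_L := h.K_mul_L
  L_mul_K := h.L_mul_K
  K_comm := h.K_comm
  K_E_L i j := by
    refine (h.K_E_L i j).trans ?_
    rw [conj_smul_def, map_zpow₀, conj_qi]
  K_F_L i j := by
    refine (h.K_F_L i j).trans ?_
    rw [conj_smul_def, map_zpow₀, conj_qi]
  E_F_same i := by
    refine (h.E_F_same i).trans ?_
    have e := conj_smul_def (D.qi i - (D.qi i)⁻¹)⁻¹ (K i - L i)
    rw [map_inv₀, map_sub, map_inv₀, conj_qi] at e
    exact e.symm
  E_F_ne := h.E_F_ne
  serre_E i j hij := (D.conj_serreSum i _ _ _).trans (h.serre_E i j hij)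
  serre_F i j hij := (D.conj_serreSum i _ _ _).trans (h.serre_F i j hij)

/-- The `*`-operation of the compact real form of `U_q(𝔤)`: the conjugate-linear
antiautomorphism with `K_i^* = K_i`, `E_i^* = K_i F_i`, `F_i^* = E_i K_i⁻¹`. -/
def starU : D.U →ₛₗ[starRingEnd ℂ] D.U where
  toFun X := MulOpposite.unop (α := D.U)
    (show D.Uᵐᵒᵖ from lift (A := ConjAlg D.Uᵐᵒᵖ) (Realizes.conj D D.realizes_star) X)
  map_add' X Y := by rw [map_add]; rfl
  map_smul' c X := by rw [map_smul]; rfl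

end Hopf

theorem comul_E (i : ι) : D.comul (D.E i) = D.E i ⊗ₜ[ℂ] D.K i + 1 ⊗ₜ[ℂ] D.E i := lift_gen _ _

theorem comul_F (i : ι) : D.comul (D.F i) = D.F i ⊗ₜ[ℂ] 1 + D.Kinv i ⊗ₜ[ℂ] D.F i :=
  lift_gen _ _

theorem comul_K (i : ι) : D.comul (D.K i) = D.K i ⊗ₜ[ℂ] D.K i := lift_gen _ _

theorem antipode_E (i : ι) : D.antipode (D.E i) = -(D.E i * D.Kinv i) :=
  congrArg MulOpposite.unop (lift_gen D.realizes_antipode (.E i))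

theorem antipode_F (i : ι) : D.antipode (D.F i) = -(D.K i * D.F i) :=
  congrArg MulOpposite.unop (lift_gen D.realizes_antipode (.F i))

theorem antipode_K (i : ι) : D.antipode (D.K i) = D.Kinv i :=
  congrArg MulOpposite.unop (lift_gen D.realizes_antipode (.K i))

theorem antipode_mul (X Y : D.U) : D.antipode (X * Y) = D.antipode Y * D.antipode X :=
  congrArg MulOpposite.unop (map_mul (lift D.realizes_antipode) X Y)

theorem starU_E (i : ι) : D.starU (D.E i) = D.K i * D.F i :=
  congrArg (MulOpposite.unop (α := D.U)) (lift_gen (Realizes.conj D D.realizes_star) (.E i))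

theorem starU_F (i : ι) : D.starU (D.F i) = D.E i * D.Kinv i :=
  congrArg (MulOpposite.unop (α := D.U)) (lift_gen (Realizes.conj D D.realizes_star) (.F i))

theorem starU_K (i : ι) : D.starU (D.K i) = D.K i :=
  congrArg (MulOpposite.unop (α := D.U)) (lift_gen (Realizes.conj D D.realizes_star) (.K i))

theorem starU_mul (X Y : D.U) : D.starU (X * Y) = D.starU Y * D.starU X :=
  congrArg (MulOpposite.unop (α := D.U)) (map_mul (lift (Realizes.conj D D.realizes_star)) X Y)

/-- `K_i` as a unit. -/
def unitK (i : ι) : D.Uˣ := ⟨D.K i, D.Kinv i, D.realizes_U.K_mul_L i, D.realizes_U.L_mul_K i⟩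

/-- `K_λ = ∏ K_i ^ n_i` for `λ = ∑ n_i α_i` in the root lattice. -/
def Kroot [Fintype ι] (n : ι → ℤ) : D.U :=
  ((Finset.univ.noncommProd (fun i => D.unitK i ^ n i) (fun i _ j _ _ =>
    Commute.zpow_zpow (Units.ext (D.realizes_U.K_comm i j)) _ _) : D.Uˣ) : D.U)

/-! ### Representations -/

section Rep

variable {D} {V : Type*} [AddCommGroup V] [Module ℂ V]

/-- The weight space of weight `μ`, where `μ` is given by its coordinates `μ i = ⟨μ, α_i^∨⟩`
in the basis of fundamental weights; `K_i` acts on it by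
`q ^ (α_i, μ) = q ^ (d_i ⟨μ, α_i^∨⟩) = q_i ^ (μ i)`. -/
def weightSpace (π : D.U →ₐ[ℂ] Module.End ℂ V) (μ : ι → ℤ) : Submodule ℂ V :=
  ⨅ i, Module.End.eigenspace (π (D.K i)) (D.qi i ^ μ i)

/-- Representations (of type 1) that are the sum of their weight spaces. -/
def IsTypeOne (π : D.U →ₐ[ℂ] Module.End ℂ V) : Prop := ⨆ μ : ι → ℤ, weightSpace π μ = ⊤

/-- `π` is the irreducible representation `V(Λ)` with dominant integral highest weight `Λ`. -/
structure IsIrrepOfHighestWeight (π : D.U →ₐ[ℂ] Module.End ℂ V) (Λ : ι → ℤ) : Prop where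
  dominant : ∀ i, 0 ≤ Λ i
  exists_highest : ∃ v ∈ weightSpace π Λ, v ≠ 0 ∧ ∀ i, π (D.E i) v = 0
  irreducible : ∀ W : Submodule ℂ V, (∀ X, ∀ w ∈ W, π X w ∈ W) → W = ⊥ ∨ W = ⊤

/-- The inner product of `V` is invariant: `X^*` acts as the adjoint of `X`. -/
def IsUnitary {V : Type*} [NormedAddCommGroup V] [InnerProductSpace ℂ V]
    (π : D.U →ₐ[ℂ] Module.End ℂ V) : Prop :=
  ∀ (X : D.U) (v w : V), inner ℂ (π X v) w = inner ℂ v (π (D.starU X) w)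

/-- The matrix coefficient `X ↦ f (X ▷ v)`. -/
def matrixCoeff (π : D.U →ₐ[ℂ] Module.End ℂ V) (f : Module.Dual ℂ V) (v : V) :
    Module.Dual ℂ D.U :=
  f ∘ₗ LinearMap.applyₗ v ∘ₗ π.toLinearMap

end Rep

/-! ### The quantized coordinate ring -/

/-- The quantized coordinate ring `ℂ_q[G]`: the span in the dual of `U_q(𝔤)` of the matrix
coefficients of finite-dimensional representations (of type 1, realized on `ℂ ^ n`). -/
def coordRing : Submodule ℂ (Module.Dual ℂ D.U) :=
  Submodule.span ℂ {φ | ∃ (n : ℕ) (π : D.U →ₐ[ℂ] Module.End ℂ (Fin n → ℂ)), IsTypeOne π ∧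
    ∃ f v, φ = matrixCoeff π f v}

variable {D} in
/-- The product `(φ ψ)(X) = (φ ⊗ ψ)(Δ(X))`. -/
def dualMul (φ ψ : Module.Dual ℂ D.U) : Module.Dual ℂ D.U :=
  LinearMap.mul' ℂ ℂ ∘ₗ TensorProduct.map φ ψ ∘ₗ D.comul.toLinearMap

variable {D} in
/-- The `*`-operation `φ^*(X) = conj (φ (S(X)^*))`. -/
def dualStar (φ : Module.Dual ℂ D.U) : Module.Dual ℂ D.U where
  toFun X := starRingEnd ℂ (φ (D.starU (D.antipode X)))
  map_add' X Y := by simp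
  map_smul' c X := by simp

variable {D} in
/-- The left action `(X ▷ φ)(Y) = φ(Y X)`. -/
def leftAct (X : D.U) (φ : Module.Dual ℂ D.U) : Module.Dual ℂ D.U := φ ∘ₗ LinearMap.mulRight ℂ X

variable {D} in
/-- The right action `(φ ◁ X)(Y) = φ(X Y)`. -/
def rightAct (φ : Module.Dual ℂ D.U) (X : D.U) : Module.Dual ℂ D.U := φ ∘ₗ LinearMap.mulLeft ℂ X

/-- `ℂ_q[G/T] = {a ∈ ℂ_q[G] : K_λ ▷ a = a for all λ}`. -/
def flagGT [Fintype ι] : Set (Module.Dual ℂ D.U) :=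
  {a | a ∈ D.coordRing ∧ ∀ n : ι → ℤ, leftAct (D.Kroot n) a = a}

/-- `ℂ_q[T\G] = {a ∈ ℂ_q[G] : a ◁ K_λ = a for all λ}`. -/
def flagTG [Fintype ι] : Set (Module.Dual ℂ D.U) :=
  {a | a ∈ D.coordRing ∧ ∀ n : ι → ℤ, rightAct a (D.Kroot n) = a}

section MatrixUnits

variable {D} {V κ : Type*} [NormedAddCommGroup V] [InnerProductSpace ℂ V] [Fintype κ]

/-- The matrix coefficients `u^i_j = f^i(X ▷ v_j)` in an orthonormal basis. -/
def u (π : D.U →ₐ[ℂ] Module.End ℂ V) (v : OrthonormalBasis κ ℂ V) (i j : κ) :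
    Module.Dual ℂ D.U :=
  matrixCoeff π (v.toBasis.coord i) (v j)

/-- The matrix unit `M^n_m`, with entries `(M^n_m)^i_j = (u^m_i)^* u^n_j`. -/
def matM (π : D.U →ₐ[ℂ] Module.End ℂ V) (v : OrthonormalBasis κ ℂ V) (n m : κ) :
    Matrix κ κ (Module.Dual ℂ D.U) :=
  Matrix.of fun i j => dualMul (dualStar (u π v m i)) (u π v n j)

/-- The matrix unit `N^n_m`, with entries `(N^n_m)^i_j = u^i_m (u^j_n)^*`. -/
def matN (π : D.U →ₐ[ℂ] Module.End ℂ V) (v : OrthonormalBasis κ ℂ V) (n m : κ) :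
    Matrix κ κ (Module.Dual ℂ D.U) :=
  Matrix.of fun i j => dualMul (u π v i m) (dualStar (u π v j n))

/-- `P = ∑ c^m_n M^n_m`, where `c m n = c^m_n`. -/
def matP (π : D.U →ₐ[ℂ] Module.End ℂ V) (v : OrthonormalBasis κ ℂ V) (c : κ → κ → ℂ) :
    Matrix κ κ (Module.Dual ℂ D.U) :=
  ∑ m, ∑ n, c m n • matM π v n m

/-- `Q = ∑ c^m_n N^n_m`, where `c m n = c^m_n`. -/
def matQ (π : D.U →ₐ[ℂ] Module.End ℂ V) (v : OrthonormalBasis κ ℂ V) (c : κ → κ → ℂ) :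
    Matrix κ κ (Module.Dual ℂ D.U) :=
  ∑ m, ∑ n, c m n • matN π v n m

end MatrixUnits

end Datum

/-! ### The Cartan datum and the weights of a simple Lie algebra -/

section LieData

open LieAlgebra LieAlgebra.IsKilling

variable {𝔤 : Type*} [LieRing 𝔤] [LieAlgebra ℂ 𝔤] [FiniteDimensional ℂ 𝔤]
  [LieAlgebra.IsSimple ℂ 𝔤] (H : LieSubalgebra ℂ 𝔤) [H.IsCartanSubalgebra]

/-- The form on `𝔥^*` induced by the Killing form. -/
def killingDual (x y : Module.Dual ℂ H) : ℂ :=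
  killingForm ℂ 𝔤 ((cartanEquivDual H).symm x) ((cartanEquivDual H).symm y)

/-- The (positive) squared length of the shortest roots for the form induced by the Killing
form. -/
def shortNormSq : ℝ :=
  ⨅ α : H.root, (killingDual H ((rootSystem H).root α) ((rootSystem H).root α)).re

/-- The form `(·, ·)` on `𝔥^*`: the multiple of the form induced by the Killing form with
`(α, α) = 2` for every short root `α`. -/
def normForm (x y : Module.Dual ℂ H) : ℂ := (2 / shortNormSq H : ℝ) * killingDual H x y

theorem killingDual_eq (x y : Module.Dual ℂ H) :
    killingDual H x y = x ((cartanEquivDual H).symm y) := by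
  have : cartanEquivDual H ((cartanEquivDual H).symm x) ((cartanEquivDual H).symm y) =
      x ((cartanEquivDual H).symm y) := by rw [LinearEquiv.apply_symm_apply]
  rw [← this]
  rfl

theorem killingDual_comm (x y : Module.Dual ℂ H) : killingDual H x y = killingDual H y x :=
  LieModule.traceForm_comm ..

theorem root_coroot (α β : H.root) :
    2 * killingDual H ((rootSystem H).root β) ((rootSystem H).root α) =
      (rootSystem H).pairingIn ℤ β α *
        killingDual H ((rootSystem H).root α) ((rootSystem H).root α) := by
  have h := root_apply_cartanEquivDual_symm_ne_zero (H.isNonZero_coe_root α)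
  have e : (((rootSystem H).pairingIn ℤ β α : ℤ) : ℂ) = (rootSystem H).pairing β α :=
    (rootSystem H).algebraMap_pairingIn ℤ β α
  rw [e, killingDual_eq, killingDual_eq, rootSystem_pairing_apply, coroot]
  simp only [rootSystem_root_apply, map_nsmul, map_smul, nsmul_eq_mul, smul_eq_mul]
  field_simp
  simp only [LieModule.Weight.toLinear_apply]
  push_cast
  ring

theorem killingDual_root_pos (α : H.root) :
    0 < (killingDual H ((rootSystem H).root α) ((rootSystem H).root α)).re := by
  have h := root_apply_cartanEquivDual_symm_ne_zero (H.isNonZero_coe_root α)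
  have h2 := root_apply_coroot (H.isNonZero_coe_root α)
  have hT := traceForm_coroot (K := ℂ) (L := 𝔤) (α : LieModule.Weight ℂ H 𝔤) (coroot α)
  have hS : LieModule.traceForm ℂ H 𝔤 (coroot (α : LieModule.Weight ℂ H 𝔤)) (coroot α) =
      ((∑ β : H.root, (rootSystem H).pairingIn ℤ β α * (rootSystem H).pairingIn ℤ β α : ℤ) : ℂ) := by
    rw [← LieAlgebra.restrict_killingForm, restrict_killingForm_eq_sum, ← Finset.sum_coe_sort]
    have e : ∀ β : H.root, (((rootSystem H).pairingIn ℤ β α : ℤ) : ℂ) = 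
        (β : LieModule.Weight ℂ H 𝔤) (coroot (α : LieModule.Weight ℂ H 𝔤)) := fun β =>
      (rootSystem H).algebraMap_pairingIn ℤ β α
    simp [e, LinearMap.sum_apply]
  have hpos : 0 < ∑ β : H.root,
      (rootSystem H).pairingIn ℤ β α * (rootSystem H).pairingIn ℤ β α := by
    refine Finset.sum_pos' (fun β _ => mul_self_nonneg _) ⟨α, Finset.mem_univ _, ?_⟩
    rw [RootPairing.pairingIn_same]
    norm_num
  have hT' := hS.symm.trans hT
  rw [h2] at hT'
  generalize (∑ β : H.root,
      (rootSystem H).pairingIn ℤ β α * (rootSystem H).pairingIn ℤ β α) = T at hT' hpos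
  rw [killingDual_eq]
  change 0 < ((α : LieModule.Weight ℂ H 𝔤) ((cartanEquivDual H).symm
    (α : LieModule.Weight ℂ H 𝔤).toLinear)).re
  have hTr : (0 : ℝ) < T := by exact_mod_cast hpos
  generalize (α : LieModule.Weight ℂ H 𝔤) ((cartanEquivDual H).symm
    (α : LieModule.Weight ℂ H 𝔤).toLinear) = s at h hT' ⊢
  have hs : s = ((4 / (T : ℝ) : ℝ) : ℂ) := by
    have : (T : ℂ) ≠ 0 := by exact_mod_cast hpos.ne'
    push_cast
    simp only [nsmul_eq_mul, smul_eq_mul] at hT'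
    field_simp at hT' ⊢
    push_cast at hT'
    linear_combination hT'
  rw [hs, Complex.ofReal_re]
  positivity

theorem shortNormSq_pos [Nonempty H.root] : 0 < shortNormSq H := by
  obtain ⟨α, hα⟩ := exists_eq_ciInf_of_finite
    (f := fun α : H.root => (killingDual H ((rootSystem H).root α) ((rootSystem H).root α)).re)
  rw [shortNormSq, ← hα]
  exact killingDual_root_pos H α

variable {H}

/-- The Cartan datum of `𝔤` with respect to the simple roots `α_i`, with
`a i j = 2 (α_i, α_j) / (α_i, α_i) = ⟨α_j, α_i^∨⟩` and `d i = (α_i, α_i) / 2`. -/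
def lieDatum (b : (rootSystem H).Base) (q : ℝ) (hq0 : 0 < q) (hq1 : q ≠ 1) :
    Datum b.support where
  a i j := (rootSystem H).pairingIn ℤ j i
  d i := (normForm H ((rootSystem H).root i) ((rootSystem H).root i)).re / 2
  q := q
  a_diag i := b.cartanMatrix_apply_same i
  a_nonpos i j hij := b.cartanMatrix_le_zero_of_ne j i hij.symm
  d_pos i := by
    have : Nonempty H.root := ⟨i⟩
    rw [normForm, Complex.re_ofReal_mul]
    have := killingDual_root_pos H i
    have := shortNormSq_pos H
    positivity
  d_symm i j := by
    have h1 := congrArg Complex.re (root_coroot H i j)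
    have h2 := congrArg Complex.re (root_coroot H j i)
    rw [killingDual_comm] at h2
    rw [← Complex.ofReal_intCast, Complex.re_ofReal_mul] at h1 h2
    simp only [normForm, Complex.re_ofReal_mul]
    have h3 := h1.symm.trans h2
    linear_combination (1 / shortNormSq H) * h3
  q_pos := hq0
  q_ne_one := hq1

/-- The weight lattice: the `μ ∈ 𝔥^*` with `⟨μ, α_i^∨⟩ ∈ ℤ` for all simple roots `α_i`. -/
def weightLattice (b : (rootSystem H).Base) : AddSubgroup (Module.Dual ℂ H) where
  carrier := {μ | ∀ i : b.support, ∃ n : ℤ, μ ((rootSystem H).coroot i) = n}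
  zero_mem' i := ⟨0, by simp⟩
  add_mem' hμ hν i := by
    obtain ⟨m, hm⟩ := hμ i
    obtain ⟨n, hn⟩ := hν i
    exact ⟨m + n, by rw [LinearMap.add_apply, hm, hn, Int.cast_add]⟩
  neg_mem' hμ i := by
    obtain ⟨m, hm⟩ := hμ i
    exact ⟨-m, by rw [LinearMap.neg_apply, hm, Int.cast_neg]⟩

/-- The coordinates `⟨μ, α_i^∨⟩` of a weight. -/
def weightCoord {b : (rootSystem H).Base} (μ : weightLattice b) (i : b.support) : ℤ :=
  (μ.2 i).choose

theorem weightCoord_spec {b : (rootSystem H).Base} (μ : weightLattice b) (i : b.support) :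
    (weightCoord μ i : ℂ) = μ.1 ((rootSystem H).coroot i) :=
  (μ.2 i).choose_spec.symm

end LieData

end QuantumGroup

end

/-!
The elements `K_i` are grouplike and satisfy `S(K_i)^* = K_i⁻¹`, and the `q_i` are real. Hence
products add the weights of functionals under the action of the torus, and the involution negates
them: `(u^m_i)^* u^n_j` has weight `λ_n - λ_m` for the right action and `u^i_m (u^j_n)^*` has weight
`λ_m - λ_n` for the left one. This gives the "if" parts, as products and involutions of matrix
coefficients are coefficients of tensor products and complex conjugates of representations.
For the converse, evaluate the invariance of the `(i, j)` entry of `P` under `K_k` at `1`, that is,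
apply the counit: since `u^i_j(1) = δ_ij`, only the term with `(m, n) = (i, j)` survives and
`c^i_j = q_k ^ ⟨λ_j - λ_i, α_k^∨⟩ c^i_j`, where `q_k > 0` is not a root of unity. The same holds for
`Q`, with `i` and `j` interchanged in the exponent.
-/

noncomputable section

namespace QuantumGroup

theorem forall_map_sum_smul_eq_iff {R M σ τ : Type*} [CommRing R] [IsDomain R] [AddCommGroup M]
    [Module R M] [Fintype σ] [DecidableEq σ] (T : τ → Module.End R M) (χ : τ → σ → R)
    {φ : σ → σ → M} (hφ : ∀ k p r, T k (φ p r) = χ k p • φ p r) (ε : Module.Dual R M)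
    (hε : ∀ p r, ε (φ p r) = if p = r then 1 else 0) (c : σ → R) :
    (∀ r k, T k (∑ p, c p • φ p r) = ∑ p, c p • φ p r) ↔ ∀ p, c p ≠ 0 → ∀ k, χ k p = 1 := by
  have hT r k : T k (∑ p, c p • φ p r) = ∑ p, (c p * χ k p) • φ p r := by
    simp only [map_sum, map_smul, hφ, smul_smul]
  constructor
  · intro h r hr k
    have hr' : c r * χ k r = c r := by
      simpa only [hT, map_sum, map_smul, hε, smul_eq_mul, mul_ite, mul_one, mul_zero,
        Finset.sum_ite_eq', Finset.mem_univ, if_true] using congrArg ε (h r k)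
    exact (mul_eq_left₀ hr).mp hr'
  · intro h r k
    rw [hT]
    refine Finset.sum_congr rfl fun p _ => ?_
    rcases eq_or_ne (c p) 0 with hp | hp
    · rw [hp, zero_mul]
    · rw [h p hp k, mul_one]

namespace Datum

variable {ι : Type*} {D : Datum ι}

theorem conj_qi_zpow (i : ι) (z : ℤ) : starRingEnd ℂ (D.qi i ^ z) = D.qi i ^ z := by
  rw [map_zpow₀, conj_qi]

theorem qi_zpow_eq_one_iff {i : ι} {z : ℤ} : D.qi i ^ z = 1 ↔ z = 0 := by
  have hpos : 0 < D.q ^ D.d i := Real.rpow_pos_of_pos D.q_pos _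
  have hne : D.q ^ D.d i ≠ 1 := by
    rw [Ne, ← Real.one_rpow (D.d i), Real.rpow_left_inj D.q_pos.le zero_le_one (D.d_pos i).ne']
    exact D.q_ne_one
  rw [← zpow_eq_one_iff_right₀ hpos.le hne, qi]
  norm_cast

theorem K_mul_Kinv (i : ι) : D.K i * D.Kinv i = 1 := D.realizes_U.K_mul_L i

theorem Kinv_mul_K (i : ι) : D.Kinv i * D.K i = 1 := D.realizes_U.L_mul_K i

theorem antipode_one : D.antipode 1 = 1 :=
  congrArg MulOpposite.unop (map_one (lift D.realizes_antipode))

theorem starU_one : D.starU 1 = 1 :=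
  congrArg (MulOpposite.unop (α := D.U)) (map_one (lift (Realizes.conj D D.realizes_star)))

theorem starU_Kinv (i : ι) : D.starU (D.Kinv i) = D.Kinv i :=
  congrArg (MulOpposite.unop (α := D.U)) (lift_gen (Realizes.conj D D.realizes_star) (.Kinv i))

theorem leftAct_one (φ : Module.Dual ℂ D.U) : leftAct 1 φ = φ := by
  simp [leftAct]

theorem rightAct_one (φ : Module.Dual ℂ D.U) : rightAct φ 1 = φ := by
  simp [rightAct]

theorem leftAct_mul (X Y : D.U) (φ : Module.Dual ℂ D.U) :
    leftAct (X * Y) φ = leftAct X (leftAct Y φ) := by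
  ext Z
  simp [leftAct]

theorem rightAct_mul (φ : Module.Dual ℂ D.U) (X Y : D.U) :
    rightAct φ (X * Y) = rightAct (rightAct φ X) Y := by
  ext Z
  simp [rightAct]

section Torus

variable [Fintype ι]

theorem Kroot_single [DecidableEq ι] (i : ι) : D.Kroot (Pi.single i 1) = D.K i := by
  refine congrArg Units.val (a₂ := D.unitK i) ?_
  calc _ = D.unitK i ^ (Pi.single i 1 : ι → ℤ) i * _ :=
        (Finset.mul_noncommProd_erase _ (Finset.mem_univ i) _ _).symm
    _ = D.unitK i ^ (Pi.single i 1 : ι → ℤ) i * 1 ^ (Finset.univ.erase i).card :=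
        congrArg _ <| Finset.noncommProd_eq_pow_card _ _ _ 1 fun j hj => by
          rw [Pi.single_eq_of_ne (Finset.ne_of_mem_erase hj), zpow_zero]
    _ = D.unitK i := by rw [Pi.single_eq_same, zpow_one, one_pow, mul_one]

theorem Kroot_induction {p : D.U → Prop} (one : p 1) (mul : ∀ X Y, p X → p Y → p (X * Y))
    (K : ∀ i, p (D.K i)) (Kinv : ∀ i, p (D.Kinv i)) (n : ι → ℤ) : p (D.Kroot n) :=
  Finset.noncommProd_induction _ _ _ (fun g : D.Uˣ => p g) (fun X Y => mul X Y) one fun i _ =>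
    zpow_induction_right (P := fun g : D.Uˣ => p g) one
      (fun X hX => mul X (D.unitK i) hX (K i)) (fun X hX => mul X ↑(D.unitK i)⁻¹ hX (Kinv i)) (n i)

theorem mem_flagGT_iff {φ : Module.Dual ℂ D.U} :
    φ ∈ D.flagGT ↔ φ ∈ D.coordRing ∧ ∀ i, leftAct (D.K i) φ = φ := by
  classical
  refine and_congr_right fun _ => ⟨fun h i => by rw [← Kroot_single, h], fun h => ?_⟩
  refine Kroot_induction (p := fun X => leftAct X φ = φ) (leftAct_one φ)
    (fun X Y hX hY => by rw [leftAct_mul, hY, hX]) h fun i => ?_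
  conv_lhs => rw [← h i, ← leftAct_mul, Kinv_mul_K, leftAct_one]

theorem mem_flagTG_iff {φ : Module.Dual ℂ D.U} :
    φ ∈ D.flagTG ↔ φ ∈ D.coordRing ∧ ∀ i, rightAct φ (D.K i) = φ := by
  classical
  refine and_congr_right fun _ => ⟨fun h i => by rw [← Kroot_single, h], fun h => ?_⟩
  refine Kroot_induction (p := fun X => rightAct φ X = φ) (rightAct_one φ)
    (fun X Y hX hY => by rw [rightAct_mul, hX, hY]) h fun i => ?_
  conv_lhs => rw [← h i, ← rightAct_mul, K_mul_Kinv, rightAct_one]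

end Torus

section Rep

variable {V W : Type*} [AddCommGroup V] [Module ℂ V] [AddCommGroup W] [Module ℂ W]

theorem mem_weightSpace_iff {π : D.U →ₐ[ℂ] Module.End ℂ V} {μ : ι → ℤ} {x : V} :
    x ∈ weightSpace π μ ↔ ∀ i, π (D.K i) x = D.qi i ^ μ i • x := by
  simp only [weightSpace, Submodule.mem_iInf, Module.End.mem_eigenspace_iff]

theorem Kinv_apply_of_mem_weightSpace {π : D.U →ₐ[ℂ] Module.End ℂ V} {μ : ι → ℤ} {x : V}
    (hx : x ∈ weightSpace π μ) (i : ι) : π (D.Kinv i) x = D.qi i ^ (-μ i) • x := by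
  have h := congrArg (fun y => D.qi i ^ (-μ i) • π (D.Kinv i) y) (mem_weightSpace_iff.mp hx i)
  simpa [← Module.End.mul_apply, ← map_mul, Kinv_mul_K, smul_smul, zpow_ne_zero, qi_ne] using h.symm

/-- The tensor product of two representations, on which `U_q(𝔤)` acts through the coproduct; its
coefficients contain the products of coefficients of the factors. -/
def tensorRep (π : D.U →ₐ[ℂ] Module.End ℂ V) (ρ : D.U →ₐ[ℂ] Module.End ℂ W) :
    D.U →ₐ[ℂ] Module.End ℂ (V ⊗[ℂ] W) :=
  (Module.endTensorEndAlgHom.comp (Algebra.TensorProduct.map π ρ)).comp D.comul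

theorem tensorRep_K (π : D.U →ₐ[ℂ] Module.End ℂ V) (ρ : D.U →ₐ[ℂ] Module.End ℂ W) (i : ι) :
    tensorRep π ρ (D.K i) = TensorProduct.map (π (D.K i)) (ρ (D.K i)) := by
  simp [tensorRep, comul_K, Module.endTensorEndAlgHom_apply,
    TensorProduct.AlgebraTensorModule.map_eq]

theorem tmul_mem_weightSpace {π : D.U →ₐ[ℂ] Module.End ℂ V} {ρ : D.U →ₐ[ℂ] Module.End ℂ W}
    {μ ν : ι → ℤ} {x : V} {y : W} (hx : x ∈ weightSpace π μ) (hy : y ∈ weightSpace ρ ν) :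
    x ⊗ₜ y ∈ weightSpace (tensorRep π ρ) (μ + ν) := by
  rw [mem_weightSpace_iff] at hx hy ⊢
  intro i
  rw [tensorRep_K, TensorProduct.map_tmul, hx, hy, TensorProduct.smul_tmul_smul, Pi.add_apply,
    zpow_add₀ (D.qi_ne i)]

theorem IsTypeOne.tensorRep {π : D.U →ₐ[ℂ] Module.End ℂ V} {ρ : D.U →ₐ[ℂ] Module.End ℂ W}
    (hπ : IsTypeOne π) (hρ : IsTypeOne ρ) : IsTypeOne (tensorRep π ρ) := by
  rw [IsTypeOne, eq_top_iff, ← TensorProduct.map₂_mk_top_top_eq_top, ← hπ, ← hρ,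
    Submodule.map₂_iSup_left, iSup_le_iff]
  intro μ
  rw [Submodule.map₂_iSup_right, iSup_le_iff]
  intro ν
  exact (Submodule.map₂_le.mpr fun x hx y hy => tmul_mem_weightSpace hx hy).trans
    (le_iSup (weightSpace _) (μ + ν))

theorem dualMul_matrixCoeff (π : D.U →ₐ[ℂ] Module.End ℂ V) (ρ : D.U →ₐ[ℂ] Module.End ℂ W)
    (f : Module.Dual ℂ V) (g : Module.Dual ℂ W) (x : V) (y : W) :
    dualMul (matrixCoeff π f x) (matrixCoeff ρ g y) =
      matrixCoeff (tensorRep π ρ) (LinearMap.mul' ℂ ℂ ∘ₗ TensorProduct.map f g) (x ⊗ₜ y) := by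
  ext X
  simp only [dualMul, matrixCoeff, tensorRep, LinearMap.comp_apply, AlgHom.toLinearMap_apply,
    AlgHom.comp_apply, LinearMap.applyₗ_apply_apply]
  induction D.comul X with
  | zero => simp
  | tmul X Y => simp [Module.endTensorEndAlgHom_apply]
  | add z w hz hw => simp only [map_add, hz, hw, LinearMap.add_apply]

theorem matrixCoeff_mem_coordRing [FiniteDimensional ℂ V] {π : D.U →ₐ[ℂ] Module.End ℂ V}
    (hπ : IsTypeOne π) (f : Module.Dual ℂ V) (x : V) : matrixCoeff π f x ∈ D.coordRing := by
  let e := (Module.finBasis ℂ V).equivFun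
  refine Submodule.subset_span
    ⟨_, (e.conjAlgEquiv ℂ).toAlgHom.comp π, ?_, f ∘ₗ e.symm.toLinearMap, e x, ?_⟩
  · rw [IsTypeOne, eq_top_iff, ← e.range, LinearMap.range_eq_map, ← hπ, Submodule.map_iSup]
    refine iSup_mono fun μ => Submodule.map_le_iff_le_comap.mpr fun y hy => ?_
    rw [Submodule.mem_comap, mem_weightSpace_iff]
    intro i
    simp [mem_weightSpace_iff.mp hy i]
  · ext X
    simp [matrixCoeff]

section Conj

variable [StarAddMonoid V] [StarModule ℂ V]

/-- The complex conjugate `X ↦ conj ∘ π (S(X)^*) ∘ conj` of a representation on a space with a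
complex conjugation `star`. It is linear and multiplicative in `X` because `X ↦ S(X)^*` is
conjugate-linear and multiplicative. -/
def conjRep (π : D.U →ₐ[ℂ] Module.End ℂ V) : D.U →ₐ[ℂ] Module.End ℂ V :=
  AlgHom.ofLinearMap
    { toFun X := (starLinearEquiv ℂ).toLinearMap ∘ₛₗ π (D.starU (D.antipode X)) ∘ₛₗ
        (starLinearEquiv ℂ).toLinearMap
      map_add' X Y := by ext; simp
      map_smul' c X := by ext; simp }
    (by ext; simp [antipode_one, starU_one])
    (fun X Y => by ext; simp [antipode_mul, starU_mul])

theorem conjRep_apply (π : D.U →ₐ[ℂ] Module.End ℂ V) (X : D.U) (x : V) :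
    conjRep π X x = star (π (D.starU (D.antipode X)) (star x)) := rfl

theorem star_mem_weightSpace {π : D.U →ₐ[ℂ] Module.End ℂ V} {μ : ι → ℤ} {x : V}
    (hx : x ∈ weightSpace π μ) :
    star x ∈ weightSpace (conjRep π) (-μ) := by
  rw [mem_weightSpace_iff]
  intro i
  rw [conjRep_apply, antipode_K, starU_Kinv, star_star, Kinv_apply_of_mem_weightSpace hx,
    star_smul, ← starRingEnd_apply, conj_qi_zpow, Pi.neg_apply]

theorem IsTypeOne.conjRep {π : D.U →ₐ[ℂ] Module.End ℂ V} (hπ : IsTypeOne π) :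
    IsTypeOne (conjRep π) := by
  rw [IsTypeOne, eq_top_iff, ← (starLinearEquiv ℂ (A := V)).range, LinearMap.range_eq_map,
    ← hπ, Submodule.map_iSup, iSup_le_iff]
  exact fun μ => (Submodule.map_le_iff_le_comap.mpr fun x hx => star_mem_weightSpace hx).trans
    (le_iSup (weightSpace _) (-μ))

theorem dualStar_matrixCoeff (π : D.U →ₐ[ℂ] Module.End ℂ V) (f : Module.Dual ℂ V) (x : V) :
    dualStar (matrixCoeff π f x) = matrixCoeff (conjRep π)
      ((starLinearEquiv ℂ).toLinearMap ∘ₛₗ f ∘ₛₗ (starLinearEquiv ℂ).toLinearMap) (star x) := by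
  ext X
  simp [dualStar, matrixCoeff, conjRep_apply]

end Conj

theorem isTypeOne_of_basis {κ : Type*} {π : D.U →ₐ[ℂ] Module.End ℂ V} (b : Module.Basis κ ℂ V)
    {w : κ → ι → ℤ} (hb : ∀ k, b k ∈ weightSpace π (w k)) : IsTypeOne π := by
  rw [IsTypeOne, eq_top_iff, ← b.span_eq, Submodule.span_le]
  rintro _ ⟨k, rfl⟩
  exact Submodule.mem_iSup_of_mem (w k) (hb k)

end Rep

theorem dualMul_mem_coordRing {φ ψ : Module.Dual ℂ D.U} (hφ : φ ∈ D.coordRing)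
    (hψ : ψ ∈ D.coordRing) : dualMul φ ψ ∈ D.coordRing := by
  let mul : Module.Dual ℂ D.U →ₗ[ℂ] Module.Dual ℂ D.U →ₗ[ℂ] Module.Dual ℂ D.U :=
    LinearMap.mk₂ ℂ dualMul
      (fun _ _ _ => by
        rw [dualMul, TensorProduct.map_add_left, LinearMap.add_comp, LinearMap.comp_add]; rfl)
      (fun _ _ _ => by
        rw [dualMul, TensorProduct.map_smul_left, LinearMap.smul_comp, LinearMap.comp_smul]; rfl)
      (fun _ _ _ => by
        rw [dualMul, TensorProduct.map_add_right, LinearMap.add_comp, LinearMap.comp_add]; rfl)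
      (fun _ _ _ => by
        rw [dualMul, TensorProduct.map_smul_right, LinearMap.smul_comp, LinearMap.comp_smul]; rfl)
  suffices Submodule.map₂ mul D.coordRing D.coordRing ≤ D.coordRing from
    this (Submodule.apply_mem_map₂ mul hφ hψ)
  rw [coordRing, Submodule.map₂_span_span, Submodule.span_le]
  rintro _ ⟨_, ⟨n, π, hπ, f, x, rfl⟩, _, ⟨m, ρ, hρ, g, y, rfl⟩, rfl⟩
  change dualMul _ _ ∈ D.coordRing
  rw [dualMul_matrixCoeff]
  exact matrixCoeff_mem_coordRing (hπ.tensorRep hρ) _ _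

theorem dualStar_mem_coordRing {φ : Module.Dual ℂ D.U} (hφ : φ ∈ D.coordRing) :
    dualStar φ ∈ D.coordRing := by
  let conj : Module.Dual ℂ D.U →ₛₗ[starRingEnd ℂ] Module.Dual ℂ D.U :=
    { toFun := dualStar
      map_add' φ ψ := by ext; simp [dualStar]
      map_smul' c φ := by ext; simp [dualStar] }
  suffices D.coordRing ≤ D.coordRing.comap conj from this hφ
  refine Submodule.span_le.mpr ?_
  rintro _ ⟨n, π, hπ, f, x, rfl⟩
  change dualStar _ ∈ D.coordRing
  rw [dualStar_matrixCoeff]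
  exact matrixCoeff_mem_coordRing hπ.conjRep _ _

/-- The functional `φ` has weight `μ` (in the coordinates of `weightSpace`) for the left
action of the torus. -/
def HasLeftWeight (φ : Module.Dual ℂ D.U) (μ : ι → ℤ) : Prop :=
  ∀ i, leftAct (D.K i) φ = D.qi i ^ μ i • φ

/-- The functional `φ` has weight `μ` (in the coordinates of `weightSpace`) for the right
action of the torus. -/
def HasRightWeight (φ : Module.Dual ℂ D.U) (μ : ι → ℤ) : Prop :=
  ∀ i, rightAct φ (D.K i) = D.qi i ^ μ i • φ

section Weights

variable {φ ψ : Module.Dual ℂ D.U} {μ ν : ι → ℤ}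

theorem leftAct_K_dualMul (i : ι) (φ ψ : Module.Dual ℂ D.U) :
    leftAct (D.K i) (dualMul φ ψ) = dualMul (leftAct (D.K i) φ) (leftAct (D.K i) ψ) := by
  ext X
  simp only [leftAct, dualMul, LinearMap.comp_apply, LinearMap.mulRight_apply,
    AlgHom.toLinearMap_apply, map_mul, comul_K]
  induction D.comul X with
  | zero => simp
  | tmul X Y => simp
  | add z w hz hw => simp only [add_mul, map_add, hz, hw]

theorem rightAct_K_dualMul (φ ψ : Module.Dual ℂ D.U) (i : ι) :
    rightAct (dualMul φ ψ) (D.K i) = dualMul (rightAct φ (D.K i)) (rightAct ψ (D.K i)) := by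
  ext X
  simp only [rightAct, dualMul, LinearMap.comp_apply, LinearMap.mulLeft_apply,
    AlgHom.toLinearMap_apply, map_mul, comul_K]
  induction D.comul X with
  | zero => simp
  | tmul X Y => simp
  | add z w hz hw => simp only [mul_add, map_add, hz, hw]

theorem leftAct_K_dualStar (i : ι) (φ : Module.Dual ℂ D.U) :
    leftAct (D.K i) (dualStar φ) = dualStar (leftAct (D.Kinv i) φ) := by
  ext X
  simp [leftAct, dualStar, antipode_mul, starU_mul, antipode_K, starU_Kinv]

theorem rightAct_K_dualStar (φ : Module.Dual ℂ D.U) (i : ι) :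
    rightAct (dualStar φ) (D.K i) = dualStar (rightAct φ (D.Kinv i)) := by
  ext X
  simp [rightAct, dualStar, antipode_mul, starU_mul, antipode_K, starU_Kinv]

theorem dualMul_smul_smul (a b : ℂ) (φ ψ : Module.Dual ℂ D.U) :
    dualMul (a • φ) (b • ψ) = (a * b) • dualMul φ ψ := by
  simp [dualMul, TensorProduct.map_smul_left, TensorProduct.map_smul_right, smul_smul,
    LinearMap.smul_comp, LinearMap.comp_smul, mul_comm]

theorem dualStar_smul (a : ℂ) (φ : Module.Dual ℂ D.U) :
    dualStar (a • φ) = starRingEnd ℂ a • dualStar φ := by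
  ext
  simp [dualStar]

theorem HasLeftWeight.leftAct_Kinv (hφ : HasLeftWeight φ μ) (i : ι) :
    leftAct (D.Kinv i) φ = D.qi i ^ (-μ i) • φ := by
  rw [zpow_neg, eq_inv_smul_iff₀ (zpow_ne_zero _ (D.qi_ne i))]
  calc D.qi i ^ μ i • leftAct (D.Kinv i) φ = leftAct (D.Kinv i) (D.qi i ^ μ i • φ) := rfl
    _ = φ := by rw [← hφ i, ← leftAct_mul, Kinv_mul_K, leftAct_one]

theorem HasRightWeight.rightAct_Kinv (hφ : HasRightWeight φ μ) (i : ι) :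
    rightAct φ (D.Kinv i) = D.qi i ^ (-μ i) • φ := by
  rw [zpow_neg, eq_inv_smul_iff₀ (zpow_ne_zero _ (D.qi_ne i))]
  calc D.qi i ^ μ i • rightAct φ (D.Kinv i) = rightAct (D.qi i ^ μ i • φ) (D.Kinv i) := rfl
    _ = φ := by rw [← hφ i, ← rightAct_mul, K_mul_Kinv, rightAct_one]

theorem HasLeftWeight.dualMul (hφ : HasLeftWeight φ μ) (hψ : HasLeftWeight ψ ν) :
    HasLeftWeight (dualMul φ ψ) (μ + ν) := fun i => by
  rw [leftAct_K_dualMul, hφ i, hψ i, dualMul_smul_smul, Pi.add_apply, zpow_add₀ (D.qi_ne i)]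

theorem HasRightWeight.dualMul (hφ : HasRightWeight φ μ) (hψ : HasRightWeight ψ ν) :
    HasRightWeight (dualMul φ ψ) (μ + ν) := fun i => by
  rw [rightAct_K_dualMul, hφ i, hψ i, dualMul_smul_smul, Pi.add_apply, zpow_add₀ (D.qi_ne i)]

theorem HasLeftWeight.dualStar (hφ : HasLeftWeight φ μ) : HasLeftWeight (dualStar φ) (-μ) :=
  fun i => by
    rw [leftAct_K_dualStar, hφ.leftAct_Kinv, dualStar_smul, conj_qi_zpow, Pi.neg_apply]

theorem HasRightWeight.dualStar (hφ : HasRightWeight φ μ) : HasRightWeight (dualStar φ) (-μ) :=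
  fun i => by
    rw [rightAct_K_dualStar, hφ.rightAct_Kinv, dualStar_smul, conj_qi_zpow, Pi.neg_apply]

end Weights

theorem dualMul_apply_one (φ ψ : Module.Dual ℂ D.U) : dualMul φ ψ 1 = φ 1 * ψ 1 := by
  simp [dualMul, Algebra.TensorProduct.one_def]

theorem dualStar_apply_one (φ : Module.Dual ℂ D.U) : dualStar φ 1 = starRingEnd ℂ (φ 1) := by
  simp [dualStar, antipode_one, starU_one]

section MatrixUnits

variable {V κ : Type*} [NormedAddCommGroup V] [InnerProductSpace ℂ V] [Fintype κ]
  (π : D.U →ₐ[ℂ] Module.End ℂ V) {v : OrthonormalBasis κ ℂ V} {w : κ → ι → ℤ}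

theorem u_apply_one [DecidableEq κ] (v : OrthonormalBasis κ ℂ V) (i j : κ) :
    u π v i j 1 = if i = j then 1 else 0 := by
  simp [u, matrixCoeff]

theorem matP_apply (v : OrthonormalBasis κ ℂ V) (c : κ → κ → ℂ) (i j : κ) :
    matP π v c i j =
      ∑ p : κ × κ, c p.1 p.2 • dualMul (dualStar (u π v p.1 i)) (u π v p.2 j) := by
  simp [matP, matM, Matrix.sum_apply, Fintype.sum_prod_type]

theorem matQ_apply (v : OrthonormalBasis κ ℂ V) (c : κ → κ → ℂ) (i j : κ) :
    matQ π v c i j =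
      ∑ p : κ × κ, c p.1 p.2 • dualMul (u π v i p.1) (dualStar (u π v j p.2)) := by
  simp [matQ, matN, Matrix.sum_apply, Fintype.sum_prod_type]

variable {π} (hv : ∀ k, v k ∈ weightSpace π (w k))
include hv

theorem u_mem_coordRing (i j : κ) : u π v i j ∈ D.coordRing :=
  have := v.toBasis.finiteDimensional_of_finite
  matrixCoeff_mem_coordRing (isTypeOne_of_basis v.toBasis fun k => by simpa using hv k) _ _

theorem hasLeftWeight_u (i j : κ) : HasLeftWeight (u π v i j) (w j) := fun k => by
  ext X
  simp [u, matrixCoeff, leftAct, mem_weightSpace_iff.mp (hv j) k]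

theorem coord_K_apply (i : κ) (k : ι) (x : V) :
    v.toBasis.coord i (π (D.K k) x) = D.qi k ^ w i k * v.toBasis.coord i x := by
  classical
  suffices v.toBasis.coord i ∘ₗ π (D.K k) = D.qi k ^ w i k • v.toBasis.coord i from
    LinearMap.congr_fun this x
  refine v.toBasis.ext fun j => ?_
  rcases eq_or_ne i j with rfl | hij
  · simp [mem_weightSpace_iff.mp (hv i) k]
  · simp [mem_weightSpace_iff.mp (hv j) k, hij]

theorem hasRightWeight_u (i j : κ) : HasRightWeight (u π v i j) (w i) := fun k => by
  ext X
  simpa [u, matrixCoeff, rightAct] using coord_K_apply hv i k (π X (v j))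

theorem matP_mem_coordRing (c : κ → κ → ℂ) (i j : κ) : matP π v c i j ∈ D.coordRing := by
  rw [matP_apply]
  exact Submodule.sum_mem _ fun p _ => Submodule.smul_mem _ _ <| dualMul_mem_coordRing
    (dualStar_mem_coordRing (u_mem_coordRing hv p.1 i)) (u_mem_coordRing hv p.2 j)

theorem matQ_mem_coordRing (c : κ → κ → ℂ) (i j : κ) : matQ π v c i j ∈ D.coordRing := by
  rw [matQ_apply]
  exact Submodule.sum_mem _ fun p _ => Submodule.smul_mem _ _ <| dualMul_mem_coordRing
    (u_mem_coordRing hv i p.1) (dualStar_mem_coordRing (u_mem_coordRing hv j p.2))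

theorem matP_mem_flagTG_iff [Fintype ι] (c : κ → κ → ℂ) :
    (∀ i j, matP π v c i j ∈ D.flagTG) ↔ ∀ m n, w m ≠ w n → c m n = 0 := by
  classical
  let φ (p r : κ × κ) := dualMul (dualStar (u π v p.1 r.1)) (u π v p.2 r.2)
  have hφ (k : ι) (p r : κ × κ) :
      (LinearMap.mulLeft ℂ (D.K k)).dualMap (φ p r) = D.qi k ^ (-w p.1 k + w p.2 k) • φ p r :=
    (hasRightWeight_u hv p.1 r.1).dualStar.dualMul (hasRightWeight_u hv p.2 r.2) k
  have hφ_one (p r : κ × κ) : Module.Dual.eval ℂ D.U 1 (φ p r) = if p = r then 1 else 0 := by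
    simp [φ, dualMul_apply_one, dualStar_apply_one, u_apply_one, Prod.ext_iff, ite_and,
      and_comm (a := p.1 = r.1)]
  calc (∀ i j, matP π v c i j ∈ D.flagTG)
      ↔ ∀ (r : κ × κ) k, rightAct (∑ p, c p.1 p.2 • φ p r) (D.K k) = ∑ p, c p.1 p.2 • φ p r := by
        simp only [mem_flagTG_iff, matP_mem_coordRing hv, true_and]
        simp only [matP_apply, Prod.forall, φ]
    _ ↔ ∀ p : κ × κ, c p.1 p.2 ≠ 0 → ∀ k, D.qi k ^ (-w p.1 k + w p.2 k) = 1 :=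
        forall_map_sum_smul_eq_iff _ _ hφ _ hφ_one fun p => c p.1 p.2
    _ ↔ ∀ m n, w m ≠ w n → c m n = 0 := by
        simp only [qi_zpow_eq_one_iff, neg_add_eq_zero, Prod.forall]
        exact forall₂_congr fun m n => by rw [← funext_iff]; exact not_imp_comm

theorem matQ_mem_flagGT_iff [Fintype ι] (c : κ → κ → ℂ) :
    (∀ i j, matQ π v c i j ∈ D.flagGT) ↔ ∀ m n, w m ≠ w n → c m n = 0 := by
  classical
  let φ (p r : κ × κ) := dualMul (u π v r.1 p.1) (dualStar (u π v r.2 p.2))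
  have hφ (k : ι) (p r : κ × κ) :
      (LinearMap.mulRight ℂ (D.K k)).dualMap (φ p r) = D.qi k ^ (w p.1 k + -w p.2 k) • φ p r :=
    (hasLeftWeight_u hv r.1 p.1).dualMul (hasLeftWeight_u hv r.2 p.2).dualStar k
  have hφ_one (p r : κ × κ) : Module.Dual.eval ℂ D.U 1 (φ p r) = if p = r then 1 else 0 := by
    simp [φ, dualMul_apply_one, dualStar_apply_one, u_apply_one, Prod.ext_iff, ite_and,
      and_comm (a := p.1 = r.1), eq_comm]
  calc (∀ i j, matQ π v c i j ∈ D.flagGT)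
      ↔ ∀ (r : κ × κ) k, leftAct (D.K k) (∑ p, c p.1 p.2 • φ p r) = ∑ p, c p.1 p.2 • φ p r := by
        simp only [mem_flagGT_iff, matQ_mem_coordRing hv, true_and]
        simp only [matQ_apply, Prod.forall, φ]
    _ ↔ ∀ p : κ × κ, c p.1 p.2 ≠ 0 → ∀ k, D.qi k ^ (w p.1 k + -w p.2 k) = 1 :=
        forall_map_sum_smul_eq_iff _ _ hφ _ hφ_one fun p => c p.1 p.2
    _ ↔ ∀ m n, w m ≠ w n → c m n = 0 := by
        simp only [qi_zpow_eq_one_iff, add_neg_eq_zero, Prod.forall]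
        exact forall₂_congr fun m n => by rw [← funext_iff]; exact not_imp_comm

end MatrixUnits

end Datum

section LieData

open LieAlgebra LieAlgebra.IsKilling

variable {𝔤 : Type*} [LieRing 𝔤] [LieAlgebra ℂ 𝔤] [FiniteDimensional ℂ 𝔤]
  [LieAlgebra.IsSimple ℂ 𝔤] {H : LieSubalgebra ℂ 𝔤} [H.IsCartanSubalgebra]

theorem weightCoord_injective (b : (rootSystem H).Base) :
    Function.Injective (weightCoord (b := b)) := by
  intro μ ν h
  refine Subtype.ext (LinearMap.ext_on
    (b.span_coroot_support.trans RootPairing.IsRootSystem.span_coroot_eq_top) ?_)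
  rintro _ ⟨i, hi, rfl⟩
  rw [← weightCoord_spec μ ⟨i, hi⟩, h, weightCoord_spec]

end LieData

end QuantumGroup

end

open QuantumGroup QuantumGroup.Datum in
theorem mainTheorem9_general {ι : Type*} [Fintype ι] {D : Datum ι} {V : Type*}
    [NormedAddCommGroup V] [InnerProductSpace ℂ V] (π : D.U →ₐ[ℂ] Module.End ℂ V)
    {κ : Type*} [Fintype κ] (v : OrthonormalBasis κ ℂ V) (w : κ → ι → ℤ)
    (hv : ∀ k, v k ∈ weightSpace π (w k)) (c : κ → κ → ℂ) :
    ((∀ i j, matP π v c i j ∈ D.flagTG) ↔ ∀ m n, w m ≠ w n → c m n = 0) ∧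
    ((∀ i j, matQ π v c i j ∈ D.flagGT) ↔ ∀ m n, w m ≠ w n → c m n = 0) :=
  ⟨matP_mem_flagTG_iff hv c, matQ_mem_flagGT_iff hv c⟩

open QuantumGroup QuantumGroup.Datum in
theorem mainTheorem9 {𝔤 : Type*} [LieRing 𝔤] [LieAlgebra ℂ 𝔤] [FiniteDimensional ℂ 𝔤]
    [LieAlgebra.IsSimple ℂ 𝔤] (H : LieSubalgebra ℂ 𝔤) [H.IsCartanSubalgebra]
    (b : (LieAlgebra.IsKilling.rootSystem H).Base) (q : ℝ) (hq0 : 0 < q) (hq1 : q ≠ 1)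
    {V : Type*} [NormedAddCommGroup V] [InnerProductSpace ℂ V] [FiniteDimensional ℂ V]
    (π : (lieDatum b q hq0 hq1).U →ₐ[ℂ] Module.End ℂ V) (Λ : weightLattice b)
    (hΛ : IsIrrepOfHighestWeight π (weightCoord Λ)) (hπ : IsUnitary π)
    {κ : Type*} [Fintype κ] (v : OrthonormalBasis κ ℂ V) (wt : κ → weightLattice b)
    (hv : ∀ k, v k ∈ weightSpace π (weightCoord (wt k))) (c : κ → κ → ℂ) :
    ((∀ i j, matP π v c i j ∈ (lieDatum b q hq0 hq1).flagTG) ↔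
      ∀ m n, wt m ≠ wt n → c m n = 0) ∧
    ((∀ i j, matQ π v c i j ∈ (lieDatum b q hq0 hq1).flagGT) ↔
      ∀ m n, wt m ≠ wt n → c m n = 0) := by
  simpa only [(weightCoord_injective b).ne_iff] using
    mainTheorem9_general π v (fun k => weightCoord (wt k)) hv c
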